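/- Let $G$ and $H$ be countable discrete groups and assume that $H$ is sofic. Let $G\wr H=\big(\bigoplus_H G\big)\rtimes H$ be the restricted regular wreath product, where $h\in H$ acts on $\bigoplus_H G$ by $(g_x)_{x\in H}\mapsto (g_{h^{-1}x})_{x\in H}$. Then: (i) if $G$ is sofic, then so is $G\wr H$; (ii) if $G$ is hyperlinear, then so is $G\wr H$; (iii) for every field $\mathbb F$, if $G$ is linear sofic over $\mathbb F$, then so is $G\wr H$; (iv) if $G$ is weakly sofic, then so is $G\wr H$. Here the notions are as follows. Let $K$ be a group with a bi-invariant metric $d$, let $\Gamma$ be a group, and let $F\subseteq\Gamma$ be finite and $\varepsilon>0$. A map $\theta\colon\Gamma\to K$ is $(F,\varepsilon,d)$-multiplicative if $\theta(1)=1$ and $d(\theta(gh),\theta(g)\theta(h))<\varepsilon$ for all $g,h\in F$. For a class $\mathcal C$ of groups with bi-invariant metrics, $\Gamma$ is $\mathcal C$-approximable if there is a function $c\colon\Gamma\setminus\{1\}\to(0,\infty)$ such that for all finite $F\subseteq\Gamma$ and $\varepsilon>0$ there are $(K,d)\in\mathcal C$ and an $(F,\varepsilon,d)$-multiplicative map $\theta\colon\Gamma\to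 K$ with $d(\theta(g),1)\ge c(g)$ for all $g\in F\setminus\{1\}$. The group $\Gamma$ is sofic if for all finite $F\subseteq\Gamma$ and $\varepsilon>0$ there are a finite non-empty set $A$ and an $(F,\varepsilon,d_{\mathrm{Hamm}})$-multiplicative map $\sigma\colon\Gamma\to\mathrm{Sym}(A)$ with $d_{\mathrm{Hamm}}(\sigma(g),1)>1-\varepsilon$ for all $g\in F\setminus\{1\}$, where $d_{\mathrm{Hamm}}(\pi,\tau)=\frac1{|A|}|\{a\in A:\pi(a)\neq\tau(a)\}|$. It is hyperlinear, linear sofic over $\mathbb F$, or weakly sofic if it is $\mathcal C$-approximable with $\mathcal C$ consisting, respectively, of the unitary groups $\mathcal U(n)$, $n\ge1$, with the metric $d(U,V)=\big(\frac1n\mathrm{Tr}((U-V)^*(U-V))\big)^{1/2}$; of the groups $\mathrm{GL}_n(\mathbb F)$, $n\ge1$, with the metric $d(A,B)=\frac1n\mathrm{rank}(A-B)$; or of all finite groups with arbitrary bi-invariant metrics. -/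

import Mathlib

namespace WreathApprox

universe u v w

/-- `d` is a metric on the group `K` with `d (a * x * b) (a * y * b) = d x y` for all
`a b x y`. -/
structure IsBiInvariantMetric {K : Type u} [Group K] (d : K → K → ℝ) : Prop where
  eq_zero_iff : ∀ x y, d x y = 0 ↔ x = y
  symm : ∀ x y, d x y = d y x
  triangle : ∀ x y z, d x z ≤ d x y + d y z
  bi_invariant : ∀ a x y b, d (a * x * b) (a * y * b) = d x y

/-- A pair `(K, d)` of a group and a bi-invariant metric on it. -/
structure BiInvariantMetricGroup where
  carrier : Type u
  [group : Group carrier]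
  dist : carrier → carrier → ℝ
  isBiInvariantMetric : IsBiInvariantMetric dist

attribute [instance] BiInvariantMetricGroup.group

/-- `(F, ε, d)`-multiplicative maps. -/
def IsMultiplicative {G : Type u} [Group G] {K : Type v} [Group K]
    (F : Finset G) (ε : ℝ) (d : K → K → ℝ) (θ : G → K) : Prop :=
  θ 1 = 1 ∧ ∀ g ∈ F, ∀ h ∈ F, d (θ (g * h)) (θ g * θ h) < ε

/-- `(F, c, d)`-injective maps. Only the values of `c` away from the identity matter. -/
def IsInjective {G : Type u} [Group G] {K : Type v} [Group K]
    (F : Finset G) (c : G → ℝ) (d : K → K → ℝ) (θ : G → K) : Prop :=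
  ∀ g ∈ F, g ≠ 1 → c g ≤ d (θ g) 1

/-- `G` is `𝒞`-approximable, for a class `𝒞` of groups with bi-invariant metrics. The function
`c` is chosen first, before `F` and `ε`. -/
def IsApproximable (G : Type u) [Group G] (𝒞 : Set BiInvariantMetricGroup.{v}) : Prop :=
  ∃ c : G → ℝ, (∀ g, g ≠ 1 → 0 < c g) ∧
    ∀ (F : Finset G) (ε : ℝ), 0 < ε →
      ∃ K ∈ 𝒞, ∃ θ : G → K.carrier,
        IsMultiplicative F ε K.dist θ ∧ IsInjective F c K.dist θ

/-! ### Sofic groups -/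

/-- The normalized Hamming distance on `Sym(A)`. -/
noncomputable def hammingDistance {A : Type u} (π τ : Equiv.Perm A) : ℝ :=
  ({a : A | π a ≠ τ a}.ncard : ℝ) / Nat.card A

/-- `(F, ε)`-free maps into `Sym(A)`. -/
def IsFree {G : Type u} [Group G] {A : Type v}
    (F : Finset G) (ε : ℝ) (σ : G → Equiv.Perm A) : Prop :=
  ∀ g ∈ F, g ≠ 1 → 1 - ε < hammingDistance (σ g) 1

/-- Sofic groups. -/
def IsSofic (G : Type u) [Group G] : Prop :=
  ∀ (F : Finset G) (ε : ℝ), 0 < ε →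
    ∃ (A : Type) (_ : Finite A) (_ : Nonempty A) (σ : G → Equiv.Perm A),
      IsMultiplicative F ε hammingDistance σ ∧ IsFree F ε σ

/-! ### Weakly sofic groups -/

/-- Weakly sofic groups: approximable by finite groups with arbitrary bi-invariant metrics. -/
def IsWeaklySofic (G : Type u) [Group G] : Prop :=
  IsApproximable G {K : BiInvariantMetricGroup.{0} | Finite K.carrier}

/-! ### Hyperlinear groups -/

/-- The normalized trace on `M_n(ℂ)`. -/
noncomputable def normalizedTrace {n : ℕ} (A : Matrix (Fin n) (Fin n) ℂ) : ℂ :=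
  (1 / (n : ℂ)) * A.trace

/-- The normalized Hilbert-Schmidt norm `tr(A* A)^{1/2}` on `M_n(ℂ)`; `tr(A* A)` is a nonnegative
real number. -/
noncomputable def hilbertSchmidtNorm {n : ℕ} (A : Matrix (Fin n) (Fin n) ℂ) : ℝ :=
  Real.sqrt (normalizedTrace (A.conjTranspose * A)).re

/-- The normalized Hilbert-Schmidt metric on the unitary group `U(n)`. -/
noncomputable def hilbertSchmidtDist {n : ℕ} (U V : Matrix.unitaryGroup (Fin n) ℂ) : ℝ :=
  hilbertSchmidtNorm ((U : Matrix (Fin n) (Fin n) ℂ) - (V : Matrix (Fin n) (Fin n) ℂ))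

section
attribute [local instance] Matrix.frobeniusNormedAddCommGroup

theorem hilbertSchmidtNorm_eq {n : ℕ} (A : Matrix (Fin n) (Fin n) ℂ) :
    hilbertSchmidtNorm A = Real.sqrt (1 / (n : ℝ)) * ‖A‖ := by
  have h : (normalizedTrace (A.conjTranspose * A)).re =
      (1 / (n : ℝ)) * ∑ i, ∑ j, ‖A i j‖ ^ 2 := by
    have h1 : (A.conjTranspose * A).trace = ((∑ i, ∑ j, ‖A i j‖ ^ 2 : ℝ) : ℂ) := by
      rw [Finset.sum_comm]
      simp only [Matrix.trace, Matrix.diag_apply, Matrix.mul_apply, Matrix.conjTranspose_apply]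
      push_cast
      refine Finset.sum_congr rfl fun i _ => Finset.sum_congr rfl fun j _ => ?_
      exact Complex.conj_mul' _
    have h2 : (1 / (n : ℂ)) = ((1 / (n : ℝ) : ℝ) : ℂ) := by push_cast; rfl
    rw [normalizedTrace, h1, h2, ← Complex.ofReal_mul, Complex.ofReal_re]
  rw [hilbertSchmidtNorm, h, Real.sqrt_mul (by positivity), Matrix.frobenius_norm_def,
    Real.sqrt_eq_rpow (∑ i, ∑ j, ‖A i j‖ ^ 2)]
  norm_cast

theorem isBiInvariantMetric_hilbertSchmidtDist {n : ℕ} (hn : 0 < n) :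
    IsBiInvariantMetric (hilbertSchmidtDist (n := n)) where
  eq_zero_iff U V := by
    have h : Real.sqrt (1 / (n : ℝ)) ≠ 0 := by positivity
    rw [hilbertSchmidtDist, hilbertSchmidtNorm_eq, mul_eq_zero, or_iff_right h, norm_eq_zero,
      sub_eq_zero, Subtype.ext_iff]
  symm U V := by
    simp only [hilbertSchmidtDist, hilbertSchmidtNorm_eq]
    rw [norm_sub_rev]
  triangle U V W := by
    simp only [hilbertSchmidtDist, hilbertSchmidtNorm_eq]
    rw [← mul_add]
    exact mul_le_mul_of_nonneg_left (norm_sub_le_norm_sub_add_norm_sub _ _ _)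
      (Real.sqrt_nonneg _)
  bi_invariant A U V B := by
    have hA : (A : Matrix (Fin n) (Fin n) ℂ).conjTranspose * (A : Matrix (Fin n) (Fin n) ℂ) = 1 :=
      Matrix.UnitaryGroup.star_mul_self A
    have hB : (B : Matrix (Fin n) (Fin n) ℂ) * (B : Matrix (Fin n) (Fin n) ℂ).conjTranspose = 1 :=
      (Matrix.mem_unitaryGroup_iff).1 B.2
    simp only [hilbertSchmidtDist, hilbertSchmidtNorm, normalizedTrace,
      Matrix.UnitaryGroup.mul_val]
    congr 3
    generalize (A : Matrix (Fin n) (Fin n) ℂ) = a at *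
    generalize (B : Matrix (Fin n) (Fin n) ℂ) = b at *
    generalize (U : Matrix (Fin n) (Fin n) ℂ) = x
    generalize (V : Matrix (Fin n) (Fin n) ℂ) = y
    have e : a * x * b - a * y * b = a * ((x - y) * b) := by noncomm_ring
    rw [e, Matrix.conjTranspose_mul, Matrix.mul_assoc, ← Matrix.mul_assoc a.conjTranspose, hA,
      Matrix.one_mul, Matrix.conjTranspose_mul, Matrix.mul_assoc, Matrix.trace_mul_comm,
      Matrix.mul_assoc, Matrix.mul_assoc, hB, Matrix.mul_one]

end

/-- The unitary group `U(n)`, `n ≥ 1`, with the normalized Hilbert-Schmidt metric. -/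
noncomputable def unitaryMetricGroup (n : ℕ) (hn : 0 < n) : BiInvariantMetricGroup.{0} where
  carrier := Matrix.unitaryGroup (Fin n) ℂ
  dist := hilbertSchmidtDist
  isBiInvariantMetric := isBiInvariantMetric_hilbertSchmidtDist hn

/-- Hyperlinear groups. -/
def IsHyperlinear (G : Type u) [Group G] : Prop :=
  IsApproximable G {K | ∃ (n : ℕ) (hn : 0 < n), K = unitaryMetricGroup n hn}

/-! ### Linear sofic groups -/

/-- The normalized rank metric on `GL_n(𝔽)`. -/
noncomputable def rankDist {𝔽 : Type w} [Field 𝔽] {n : ℕ} (A B : GL (Fin n) 𝔽) : ℝ :=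
  (((A : Matrix (Fin n) (Fin n) 𝔽) - (B : Matrix (Fin n) (Fin n) 𝔽)).rank : ℝ) / n

theorem matrixRank_eq_zero_iff {𝔽 : Type w} [Field 𝔽] {n : ℕ} (A : Matrix (Fin n) (Fin n) 𝔽) :
    A.rank = 0 ↔ A = 0 := by
  rw [Matrix.rank, Submodule.finrank_eq_zero, LinearMap.range_eq_bot]
  exact ⟨fun h => Matrix.toLin'.injective (by rw [map_zero]; exact h), fun h => by simp [h]⟩

theorem matrixRank_neg {𝔽 : Type w} [Field 𝔽] {n : ℕ} (A : Matrix (Fin n) (Fin n) 𝔽) :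
    (-A).rank = A.rank := by
  have h : (-A).mulVecLin = -A.mulVecLin := by
    ext
    simp
  rw [Matrix.rank, Matrix.rank, h, LinearMap.range_neg]

theorem matrixRank_add_le {𝔽 : Type w} [Field 𝔽] {n : ℕ} (A B : Matrix (Fin n) (Fin n) 𝔽) :
    (A + B).rank ≤ A.rank + B.rank := by
  rw [Matrix.rank, Matrix.rank, Matrix.rank, Matrix.mulVecLin_add]
  exact (Submodule.finrank_mono (LinearMap.range_add_le _ _)).trans
    (Submodule.finrank_add_le_finrank_add_finrank _ _)

theorem isBiInvariantMetric_rankDist (𝔽 : Type w) [Field 𝔽] {n : ℕ} (hn : 0 < n) :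
    IsBiInvariantMetric (rankDist (𝔽 := 𝔽) (n := n)) where
  eq_zero_iff A B := by
    have h : (n : ℝ) ≠ 0 := by positivity
    rw [rankDist, div_eq_zero_iff, or_iff_left h, Nat.cast_eq_zero, matrixRank_eq_zero_iff,
      sub_eq_zero, Units.ext_iff]
  symm A B := by
    rw [rankDist, rankDist, ← neg_sub, matrixRank_neg]
  triangle A B C := by
    rw [rankDist, rankDist, rankDist, ← add_div]
    refine div_le_div_of_nonneg_right ?_ (Nat.cast_nonneg n)
    rw [← sub_add_sub_cancel (A : Matrix (Fin n) (Fin n) 𝔽) B C]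
    exact_mod_cast matrixRank_add_le _ _
  bi_invariant P A B Q := by
    have e : ((P * A * Q : GL (Fin n) 𝔽) : Matrix (Fin n) (Fin n) 𝔽) -
        ((P * B * Q : GL (Fin n) 𝔽) : Matrix (Fin n) (Fin n) 𝔽) =
        (P : Matrix (Fin n) (Fin n) 𝔽) * ((A : Matrix (Fin n) (Fin n) 𝔽) - B) * Q := by
      push_cast
      noncomm_ring
    have hP : IsUnit (P : Matrix (Fin n) (Fin n) 𝔽).det :=
      (Matrix.isUnit_iff_isUnit_det _).1 P.isUnit
    have hQ : IsUnit (Q : Matrix (Fin n) (Fin n) 𝔽).det :=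
      (Matrix.isUnit_iff_isUnit_det _).1 Q.isUnit
    rw [rankDist, rankDist, e, Matrix.rank_mul_eq_left_of_isUnit_det _ _ hQ,
      Matrix.rank_mul_eq_right_of_isUnit_det _ _ hP]

/-- The general linear group `GL_n(𝔽)`, `n ≥ 1`, with the normalized rank metric. -/
noncomputable def generalLinearMetricGroup (𝔽 : Type w) [Field 𝔽] (n : ℕ) (hn : 0 < n) :
    BiInvariantMetricGroup.{w} where
  carrier := GL (Fin n) 𝔽
  dist := rankDist
  isBiInvariantMetric := isBiInvariantMetric_rankDist 𝔽 hn

/-- Linear sofic groups over the field `𝔽`. -/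
def IsLinearSofic (𝔽 : Type w) [Field 𝔽] (G : Type u) [Group G] : Prop :=
  IsApproximable G {K | ∃ (n : ℕ) (hn : 0 < n), K = generalLinearMetricGroup 𝔽 n hn}

/-! ### Wreath products -/

/-- The restricted regular wreath product `G ≀ H = (⨁_H G) ⋊ H`, as the subgroup of the
unrestricted one `(H → G) ⋊ H` of the elements whose first component is finitely supported.
The multiplication is `(g, h) (g', h') = (g * α_h(g'), h * h')` with
`α_h(g')(x) = g' (h⁻¹ * x)`. -/
def restrictedWreathProduct (G : Type u) (H : Type v) [Group G] [Group H] :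
    Subgroup (RegularWreathProduct G H) where
  carrier := {x | (Function.mulSupport x.left).Finite}
  one_mem' := by simp
  mul_mem' {x y} hx hy := by
    have h : (Function.mulSupport fun z => y.left (x.right⁻¹ * z)).Finite :=
      Set.Finite.preimage (f := fun z => x.right⁻¹ * z) (mul_right_injective _).injOn hy
    exact (Set.Finite.union hx h).subset (Function.mulSupport_mul _ _)
  inv_mem' {x} hx := by
    have h : (Function.mulSupport fun z => x.left (x.right * z)).Finite :=
      Set.Finite.preimage (f := fun z => x.right * z) (mul_right_injective _).injOn hx
    refine h.subset fun z hz => ?_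
    simpa using hz

end WreathApprox

namespace WreathApprox

universe u v w

/-! ### Bi-invariant metrics -/

namespace IsBiInvariantMetric

variable {K : Type*} [Group K] {d : K → K → ℝ}

/-! Soficity of `H` provides maps `σ h` in `Sym(B)` for which most points `b` are good: near `b` the
partial orbit map `x ↦ (σ x)⁻¹ b` is injective and turns products in `H` into iterated moves. Given
an approximate homomorphism `θ : G → K`, a finitely supported `g : H → G` can therefore be copied
around a good `b` as an element of `K^B` (`windowMap`), with the value `θ (g x)` at `(σ x)⁻¹ b`.
Translating `g` by `h` has the same effect as replacing `b` by `(σ h)⁻¹ b` (`windowMap_translate`).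
So, after applying homomorphisms `K^B → L`, these copies, indexed by `b`, together with the
permutation `σ h`, form an almost multiplicative map from `G ≀ H` to the permutational wreath
product of `L` with `Sym(B × I)` (`IsSofic.exists_wreath_map`). The set `I` is a parameter of the
homomorphisms used.

The homomorphisms `K^B → L` come from tensor powers. They are isometric on single coordinates, but
coordinates may cancel, as in `λ ⊗ λ⁻¹ = 1` for scalars. The remedy is to average over all subsets
of `B`: two restrictions of an element that differ by one coordinate have images as far apart as
that coordinate is from `1`, so at least half of its truncated length survives on average
(`half_min_le_sum_piRestrict`). This costs only a constant factor, which approximability allows.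

Finally the permutational wreath product must be represented in the class again
(`IsPermWreathClosed`): by itself for finite groups, by block monomial matrices for linear and
unitary groups. Three estimates suffice: small elements stay small, elements of the base group stay
far from `1`, and so do elements that move many points. The square root in the first is forced by
the Hilbert-Schmidt metric, whose square is what averages over blocks.

Soficity itself demands displacement close to `1`, so it is treated separately. The product action
on `A^B` has no cancellation, so no averaging is needed, and the imprimitive action preserves the
distance to `1` exactly. -/

theorem self_eq_zero (hd : IsBiInvariantMetric d) (x : K) : d x x = 0 :=
  (hd.eq_zero_iff x x).2 rfl

theorem nonneg (hd : IsBiInvariantMetric d) (x y : K) : 0 ≤ d x y := by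
  have h := hd.triangle x y x
  rw [hd.self_eq_zero, hd.symm y x] at h
  linarith

theorem mul_left_eq (hd : IsBiInvariantMetric d) (a x y : K) : d (a * x) (a * y) = d x y := by
  simpa using hd.bi_invariant a x y 1

theorem mul_right_eq (hd : IsBiInvariantMetric d) (x y b : K) : d (x * b) (y * b) = d x y := by
  simpa using hd.bi_invariant 1 x y b

theorem eq_mul_inv_one (hd : IsBiInvariantMetric d) (x y : K) : d x y = d (x * y⁻¹) 1 := by
  simpa using (hd.mul_right_eq x y y⁻¹).symm

theorem inv_inv_eq (hd : IsBiInvariantMetric d) (x y : K) : d x⁻¹ y⁻¹ = d x y := by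
  rw [hd.symm x y]
  simpa using (hd.bi_invariant x x⁻¹ y⁻¹ y).symm

theorem le_one_add_one (hd : IsBiInvariantMetric d) (x y : K) : d x y ≤ d x 1 + d y 1 := by
  rw [hd.symm y 1]
  exact hd.triangle x 1 y

end IsBiInvariantMetric

/-- Reduces every estimate on a homomorphism to distances from `1`, the only distances recorded in
the closure properties below. -/
theorem BiInvariantMetricGroup.dist_map_eq {K : Type*} [Group K] (M : BiInvariantMetricGroup)
    (f : K →* M.carrier) (x y : K) : M.dist (f x) (f y) = M.dist (f (x * y⁻¹)) 1 := by
  rw [M.isBiInvariantMetric.eq_mul_inv_one, map_mul, map_inv]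

/-! ### The metric on permutational wreath products -/

/-- The permutational wreath product of `K` with the symmetric group of `X`. -/
abbrev PermWreath (K : Type*) [Group K] (X : Type*) : Type _ :=
  (X → K) ⋊[(mulAutArrow : Equiv.Perm X →* MulAut (X → K))] Equiv.Perm X

namespace PermWreath

variable {K : Type*} [Group K] {X : Type*}

theorem mul_left_apply (p q : PermWreath K X) (x : X) :
    (p * q).left x = p.left x * q.left (p.right⁻¹ x) := rfl

theorem inv_right_apply (p q : PermWreath K X) (x : X) :
    (p * q).right⁻¹ x = q.right⁻¹ (p.right⁻¹ x) := by
  simp [mul_inv_rev]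

theorem inv_left_apply (p : PermWreath K X) (x : X) :
    (p⁻¹).left x = (p.left (p.right x))⁻¹ := by
  simp [mulAutArrow, SemidirectProduct.inv_left]
  rfl

instance [Finite K] [Finite X] : Finite (PermWreath K X) :=
  Finite.of_equiv ((X → K) × Equiv.Perm X) SemidirectProduct.equivProd.symm

open Classical in
/-- The contribution of the coordinate `x` to the distance of two elements of the permutational
wreath product. -/
noncomputable def coordDist (d : K → K → ℝ) (p q : PermWreath K X) (x : X) : ℝ :=
  if p.right⁻¹ x = q.right⁻¹ x then min (d (p.left x) (q.left x)) 1 else 1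

/-- The normalized metric on the permutational wreath product. -/
noncomputable def wreathDist [Fintype X] (d : K → K → ℝ) (p q : PermWreath K X) : ℝ :=
  (∑ x, coordDist d p q x) / Fintype.card X

variable {d : K → K → ℝ}

theorem coordDist_of_eq {p q : PermWreath K X} {x : X} (h : p.right⁻¹ x = q.right⁻¹ x) :
    coordDist d p q x = min (d (p.left x) (q.left x)) 1 := if_pos h

theorem coordDist_of_ne {p q : PermWreath K X} {x : X} (h : p.right⁻¹ x ≠ q.right⁻¹ x) :
    coordDist d p q x = 1 := if_neg h

theorem coordDist_le_one (p q : PermWreath K X) (x : X) : coordDist d p q x ≤ 1 := by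
  unfold coordDist
  split_ifs
  exacts [min_le_right _ _, le_rfl]

theorem coordDist_nonneg (hd : IsBiInvariantMetric d) (p q : PermWreath K X) (x : X) :
    0 ≤ coordDist d p q x := by
  unfold coordDist
  split_ifs
  exacts [le_min (hd.nonneg _ _) zero_le_one, zero_le_one]

/-- The truncation at `1` is essential: when the permutations of `p` and `r` agree at `x` but that
of `q` does not, the right side is at least `1`, which bounds the left side only because of it. -/
theorem coordDist_triangle (hd : IsBiInvariantMetric d) (p q r : PermWreath K X) (x : X) :
    coordDist d p r x ≤ coordDist d p q x + coordDist d q r x := by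
  by_cases h₁ : p.right⁻¹ x = q.right⁻¹ x
  · by_cases h₂ : q.right⁻¹ x = r.right⁻¹ x
    · rw [coordDist_of_eq h₁, coordDist_of_eq h₂, coordDist_of_eq (h₁.trans h₂)]
      have := hd.triangle (p.left x) (q.left x) (r.left x)
      have := hd.nonneg (p.left x) (q.left x)
      have := hd.nonneg (q.left x) (r.left x)
      rcases min_cases (d (p.left x) (q.left x)) 1 with h | h <;>
        rcases min_cases (d (q.left x) (r.left x)) 1 with h' | h' <;>
        rcases min_cases (d (p.left x) (r.left x)) 1 with h'' | h'' <;> linarith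
    · rw [coordDist_of_ne h₂]
      linarith [coordDist_le_one (d := d) p r x, coordDist_nonneg hd p q x]
  · rw [coordDist_of_ne h₁]
    linarith [coordDist_le_one (d := d) p r x, coordDist_nonneg hd q r x]

theorem coordDist_symm (hd : IsBiInvariantMetric d) (p q : PermWreath K X) (x : X) :
    coordDist d p q x = coordDist d q p x := by
  unfold coordDist
  rw [hd.symm, eq_comm (a := p.right⁻¹ x)]

theorem coordDist_mul_left (hd : IsBiInvariantMetric d) (a p q : PermWreath K X) (x : X) :
    coordDist d (a * p) (a * q) x = coordDist d p q (a.right⁻¹ x) := by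
  unfold coordDist
  rw [inv_right_apply, inv_right_apply, mul_left_apply, mul_left_apply, hd.mul_left_eq]

theorem coordDist_mul_right (hd : IsBiInvariantMetric d) (p q b : PermWreath K X) (x : X) :
    coordDist d (p * b) (q * b) x = coordDist d p q x := by
  unfold coordDist
  rw [inv_right_apply, inv_right_apply, mul_left_apply, mul_left_apply,
    EmbeddingLike.apply_eq_iff_eq]
  split_ifs with h
  · rw [h, hd.mul_right_eq]
  · rfl

theorem coordDist_eq_zero_iff (hd : IsBiInvariantMetric d) (p q : PermWreath K X) (x : X) :
    coordDist d p q x = 0 ↔ p.right⁻¹ x = q.right⁻¹ x ∧ p.left x = q.left x := by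
  by_cases h : p.right⁻¹ x = q.right⁻¹ x
  · rw [coordDist_of_eq h, ← hd.eq_zero_iff]
    have := hd.nonneg (p.left x) (q.left x)
    constructor
    · intro h'
      rcases min_cases (d (p.left x) (q.left x)) 1 with h'' | h'' <;>
        exact ⟨h, by linarith⟩
    · rintro ⟨-, h'⟩
      simp [h']
  · rw [coordDist_of_ne h]
    exact iff_of_false one_ne_zero fun h' => h h'.1

variable [Fintype X]

open Classical in
/-- The points moved by the permutation component. -/
noncomputable def moved (p : PermWreath K X) : Finset X :=
  Finset.univ.filter fun x => p.right⁻¹ x ≠ x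

theorem mem_moved {p : PermWreath K X} {x : X} : x ∈ moved p ↔ p.right⁻¹ x ≠ x := by
  simp only [moved, Finset.mem_filter, Finset.mem_univ, true_and]

theorem wreathDist_le_one (p q : PermWreath K X) : wreathDist d p q ≤ 1 := by
  refine div_le_one_of_le₀ ?_ (Nat.cast_nonneg _)
  calc ∑ x, coordDist d p q x ≤ ∑ _x : X, (1 : ℝ) :=
        Finset.sum_le_sum fun x _ => coordDist_le_one p q x
    _ = Fintype.card X := by simp

theorem isBiInvariantMetric_wreathDist [Nonempty X] (hd : IsBiInvariantMetric d) :
    IsBiInvariantMetric (wreathDist d : PermWreath K X → PermWreath K X → ℝ) where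
  eq_zero_iff p q := by
    have hX : (Fintype.card X : ℝ) ≠ 0 := by positivity
    rw [wreathDist, div_eq_zero_iff, or_iff_left hX,
      Finset.sum_eq_zero_iff_of_nonneg fun x _ => coordDist_nonneg hd p q x]
    simp only [Finset.mem_univ, true_imp_iff, coordDist_eq_zero_iff hd]
    constructor
    · intro h
      refine SemidirectProduct.ext (funext fun x => (h x).2) (inv_injective ?_)
      exact Equiv.ext fun x => (h x).1
    · rintro rfl x
      exact ⟨rfl, rfl⟩
  symm p q := by
    simp only [wreathDist, coordDist_symm hd p q]
  triangle p q r := by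
    rw [wreathDist, wreathDist, wreathDist, ← add_div, ← Finset.sum_add_distrib]
    exact div_le_div_of_nonneg_right
      (Finset.sum_le_sum fun x _ => coordDist_triangle hd p q r x) (Nat.cast_nonneg _)
  bi_invariant a p q b := by
    simp only [wreathDist, coordDist_mul_right hd, coordDist_mul_left hd]
    rw [Equiv.sum_comp a.right⁻¹ (coordDist d p q)]

end PermWreath

/-! ### Tensor powers and random restriction of coordinates -/

/-- A class of groups with bi-invariant metrics is closed under tensor products if for all of its
members `K` and `L` there is a homomorphism from `K × L` to a member of the class, isometric on
each of the two factors. -/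
def IsTensorClosed (𝒞 : Set BiInvariantMetricGroup.{v}) : Prop :=
  ∀ K ∈ 𝒞, ∀ L ∈ 𝒞, ∃ M ∈ 𝒞, ∃ τ : K.carrier × L.carrier →* M.carrier,
    (∀ a, M.dist (τ (a, 1)) 1 = K.dist a 1) ∧ ∀ b, M.dist (τ (1, b)) 1 = L.dist b 1

/-- Tensoring with one more copy of `K` preserves isometry on each factor. Nothing is claimed about
elements with several nontrivial coordinates, where cancellation is possible. -/
theorem IsTensorClosed.exists_fin_power {𝒞 : Set BiInvariantMetricGroup.{v}}
    (h𝒞 : IsTensorClosed 𝒞) {K : BiInvariantMetricGroup.{v}} (hK : K ∈ 𝒞) (n : ℕ) :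
    ∃ M ∈ 𝒞, ∃ τ : (Fin n → K.carrier) →* M.carrier,
      ∀ i a, M.dist (τ (Pi.mulSingle i a)) 1 = K.dist a 1 := by
  induction n with
  | zero => exact ⟨K, hK, 1, fun i => i.elim0⟩
  | succ n ih =>
    obtain ⟨L, hL, τ, hτ⟩ := ih
    obtain ⟨M, hM, μ, hμ₁, hμ₂⟩ := h𝒞 L hL K hK
    let tail : (Fin (n + 1) → K.carrier) →* (Fin n → K.carrier) :=
      { toFun := fun k i => k i.succ, map_one' := rfl, map_mul' := fun _ _ => rfl }
    refine ⟨M, hM, μ.comp ((τ.comp tail).prod (Pi.evalMonoidHom _ 0)), fun i a => ?_⟩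
    refine Fin.cases ?_ (fun j => ?_) i
    · have h : tail (Pi.mulSingle 0 a) = 1 := by
        funext j
        exact Pi.mulSingle_eq_of_ne (Fin.succ_ne_zero j) a
      simp [h, hμ₂]
    · have h : tail (Pi.mulSingle j.succ a) = Pi.mulSingle j a := by
        funext k
        change (Pi.mulSingle j.succ a : Fin (n + 1) → K.carrier) k.succ = _
        simp [Pi.mulSingle_apply]
      simp [h, hμ₁, hτ]

theorem IsTensorClosed.exists_power {𝒞 : Set BiInvariantMetricGroup.{v}}
    (h𝒞 : IsTensorClosed 𝒞) {K : BiInvariantMetricGroup.{v}} (hK : K ∈ 𝒞) (B : Type*)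
    [Fintype B] [DecidableEq B] :
    ∃ M ∈ 𝒞, ∃ τ : (B → K.carrier) →* M.carrier,
      ∀ i a, M.dist (τ (Pi.mulSingle i a)) 1 = K.dist a 1 := by
  obtain ⟨M, hM, τ, hτ⟩ := h𝒞.exists_fin_power hK (Fintype.card B)
  let e := Fintype.equivFin B
  let f : (B → K.carrier) →* (Fin (Fintype.card B) → K.carrier) :=
    { toFun := fun k i => k (e.symm i), map_one' := rfl, map_mul' := fun _ _ => rfl }
  refine ⟨M, hM, τ.comp f, fun i a => ?_⟩
  have h : f (Pi.mulSingle i a) = Pi.mulSingle (e i) a := by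
    funext j
    change (Pi.mulSingle i a : B → K.carrier) (e.symm j) = _
    simp [Pi.mulSingle_apply, Equiv.symm_apply_eq]
  rw [MonoidHom.comp_apply, h, hτ]

section

variable {K L : Type*} [Group K] [Group L] {d : K → K → ℝ} {d' : L → L → ℝ}
  {B : Type*} [DecidableEq B]

/-- A homomorphism from a power of `K` that is `1`-Lipschitz in each coordinate is `1`-Lipschitz
for the sum metric. -/
theorem dist_map_pi_one_le_sum (hd' : IsBiInvariantMetric d') (f : (B → K) →* L)
    (hf : ∀ β a, d' (f (Pi.mulSingle β a)) 1 ≤ d a 1) (T : Finset B) (u : B → K)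
    (hu : ∀ β ∉ T, u β = 1) : d' (f u) 1 ≤ ∑ β ∈ T, d (u β) 1 := by
  induction T using Finset.induction_on generalizing u with
  | empty =>
    have : u = 1 := funext fun β => hu β (Finset.notMem_empty β)
    rw [this, map_one, hd'.self_eq_zero, Finset.sum_empty]
  | insert β T hβ ih =>
    have h : u = Pi.mulSingle β (u β) * Function.update u β 1 := by
      funext γ
      by_cases hγ : γ = β
      · subst hγ; simp
      · simp [hγ]
    have h₁ : d' (f u) 1 ≤ d' (f (Pi.mulSingle β (u β))) 1 +
        d' (f (Function.update u β 1)) 1 := by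
      calc d' (f u) 1 = d' (f (Pi.mulSingle β (u β)) * f (Function.update u β 1)) 1 := by
            rw [← map_mul, ← h]
        _ ≤ d' (f (Pi.mulSingle β (u β)) * f (Function.update u β 1))
              (f (Function.update u β 1)) + d' (f (Function.update u β 1)) 1 :=
            hd'.triangle _ _ _
        _ = _ := by
            congr 1
            simpa using hd'.mul_right_eq (f (Pi.mulSingle β (u β))) 1 (f (Function.update u β 1))
    have h₂ := ih (Function.update u β 1) fun γ hγ => by
      by_cases hγβ : γ = β
      · subst hγβ; simp
      · simp [hγβ, hu γ (by simp [hγβ, hγ])]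
    have h₃ : ∑ γ ∈ T, d (Function.update u β 1 γ) 1 = ∑ γ ∈ T, d (u γ) 1 :=
      Finset.sum_congr rfl fun γ hγ => by
        rw [Function.update_of_ne (ne_of_mem_of_not_mem hγ hβ)]
    rw [Finset.sum_insert hβ]
    linarith [hf β (u β)]

theorem dist_map_pi_le_sum (hd : IsBiInvariantMetric d) (hd' : IsBiInvariantMetric d')
    (f : (B → K) →* L) (hf : ∀ β a, d' (f (Pi.mulSingle β a)) 1 ≤ d a 1) (T : Finset B)
    (u v : B → K) (huv : ∀ β ∉ T, u β = v β) :
    d' (f u) (f v) ≤ ∑ β ∈ T, d (u β) (v β) := by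
  rw [hd'.eq_mul_inv_one, ← map_inv, ← map_mul]
  refine (dist_map_pi_one_le_sum hd' f hf T _ fun β hβ => by simp [huv β hβ]).trans_eq ?_
  exact Finset.sum_congr rfl fun β _ => (hd.eq_mul_inv_one _ _).symm

/-- The endomorphism of a power of `K` that keeps the coordinates in `S`. -/
def piRestrict (K : Type*) [Group K] (S : Finset B) : (B → K) →* (B → K) where
  toFun u β := if β ∈ S then u β else 1
  map_one' := by funext β; simp
  map_mul' u v := by funext β; by_cases h : β ∈ S <;> simp [h]

theorem piRestrict_apply (S : Finset B) (u : B → K) (β : B) :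
    piRestrict K S u β = if β ∈ S then u β else 1 := rfl

theorem piRestrict_mulSingle (S : Finset B) (β : B) (a : K) :
    piRestrict K S (Pi.mulSingle β a) = if β ∈ S then Pi.mulSingle β a else 1 := by
  funext γ
  rw [piRestrict_apply]
  by_cases hγ : γ = β
  · subst hγ
    split_ifs <;> simp
  · split_ifs <;> simp [hγ]

theorem dist_map_piRestrict_mulSingle_le (hd : IsBiInvariantMetric d)
    (hd' : IsBiInvariantMetric d') (f : (B → K) →* L)
    (hf : ∀ β a, d' (f (Pi.mulSingle β a)) 1 = d a 1) (S : Finset B) (β : B) (a : K) :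
    d' (f (piRestrict K S (Pi.mulSingle β a))) 1 ≤ d a 1 := by
  rw [piRestrict_mulSingle]
  split_ifs
  · exact (hf β a).le
  · rw [map_one, hd'.self_eq_zero]
    exact hd.nonneg _ _

/-- Restricting to a random set of coordinates keeps half of the distance to `1` of each
coordinate, whatever the other coordinates are. -/
theorem half_min_le_sum_piRestrict [Fintype B] (hd' : IsBiInvariantMetric d')
    (f : (B → K) →* L) (hf : ∀ β a, d' (f (Pi.mulSingle β a)) 1 = d a 1) (u : B → K) (β : B) :
    1 / 2 * Fintype.card (Finset B) * min (d (u β) 1) 1 ≤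
      ∑ S : Finset B, min (d' (f (piRestrict K S u)) 1) 1 := by
  set F : Finset B → ℝ := fun S => min (d' (f (piRestrict K S u)) 1) 1 with hF
  have hinv : Function.Involutive fun S : Finset B => symmDiff S {β} := fun S => by
    simp
  have hsum : ∑ S, F (symmDiff S {β}) = ∑ S, F S := Equiv.sum_comp hinv.toPerm F
  -- The sets `S` and `symmDiff S {β}` differ only in `β`, so the images of the two restrictions of
  -- `u` are at distance `d (u β) 1`, and both cannot be close to `1`. Summing over all `S` counts
  -- each term twice, whence the factor `1 / 2`.
  have hpair : ∀ S, min (d (u β) 1) 1 ≤ F S + F (symmDiff S {β}) := by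
    intro S
    have key : d' (f (piRestrict K S u)) (f (piRestrict K (symmDiff S {β}) u)) = d (u β) 1 := by
      wlog hβ : β ∈ S generalizing S
      · have := this (symmDiff S {β}) (by simp [Finset.mem_symmDiff, hβ])
        rwa [symmDiff_assoc, symmDiff_self, symmDiff_bot, hd'.symm] at this
      rw [hd'.eq_mul_inv_one, ← map_inv, ← map_mul, ← hf β (u β)]
      congr 2
      funext γ
      by_cases hγ : γ = β
      · subst hγ
        simp [piRestrict_apply, hβ, Finset.mem_symmDiff]
      · by_cases hγS : γ ∈ S <;> simp [piRestrict_apply, hγ, hγS, Finset.mem_symmDiff]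
    have h₁ := hd'.le_one_add_one (f (piRestrict K S u)) (f (piRestrict K (symmDiff S {β}) u))
    have h₂ := hd'.nonneg (f (piRestrict K S u)) 1
    have h₃ := hd'.nonneg (f (piRestrict K (symmDiff S {β}) u)) 1
    rw [key] at h₁
    have e₁ : F S = min (d' (f (piRestrict K S u)) 1) 1 := rfl
    have e₂ : F (symmDiff S {β}) = min (d' (f (piRestrict K (symmDiff S {β}) u)) 1) 1 := rfl
    rw [e₁, e₂]
    rcases min_cases (d' (f (piRestrict K S u)) 1) 1 with h | h <;>
      rcases min_cases (d' (f (piRestrict K (symmDiff S {β}) u)) 1) 1 with h' | h' <;>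
      rcases min_cases (d (u β) 1) 1 with h'' | h'' <;> linarith
  have h := Finset.sum_le_sum fun S (_ : S ∈ Finset.univ) => hpair S
  rw [Finset.sum_add_distrib, hsum, Finset.sum_const, nsmul_eq_mul, Finset.card_univ] at h
  linarith

end

/-! ### The Hamming metric and good points of sofic approximations -/

section Hamming

variable {A : Type*}

theorem hammingDistance_eq [Fintype A] [DecidableEq A] (π τ : Equiv.Perm A) :
    hammingDistance π τ =
      ((Finset.univ.filter fun a => π a ≠ τ a).card : ℝ) / Fintype.card A := by
  rw [hammingDistance, Set.ncard_eq_toFinset_card', Set.toFinset_ofPred, Nat.card_eq_fintype_card]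

theorem isBiInvariantMetric_hammingDistance [Finite A] [Nonempty A] :
    IsBiInvariantMetric (hammingDistance (A := A)) where
  eq_zero_iff π τ := by
    have hA : (Nat.card A : ℝ) ≠ 0 := by exact_mod_cast Nat.card_pos.ne'
    rw [hammingDistance, div_eq_zero_iff, or_iff_left hA, Nat.cast_eq_zero,
      Set.ncard_eq_zero (Set.toFinite _), Set.eq_empty_iff_forall_notMem]
    simp [Equiv.ext_iff]
  symm π τ := by simp only [hammingDistance, ne_comm]
  triangle π τ ρ := by
    rw [hammingDistance, hammingDistance, hammingDistance, ← add_div]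
    refine div_le_div_of_nonneg_right ?_ (Nat.cast_nonneg _)
    have h : {a | π a ≠ ρ a} ⊆ {a | π a ≠ τ a} ∪ {a | τ a ≠ ρ a} := fun a ha => by
      by_contra h'
      simp only [Set.mem_union, Set.mem_ofPred_eq, not_or, not_not] at h'
      exact ha (h'.1.trans h'.2)
    exact_mod_cast (Set.ncard_le_ncard h (Set.toFinite _)).trans (Set.ncard_union_le _ _)
  bi_invariant α π τ β := by
    have h : {a | (α * π * β) a ≠ (α * τ * β) a} = β ⁻¹' {a | π a ≠ τ a} := by
      ext a
      simp
    rw [hammingDistance, hammingDistance, h,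
      Set.ncard_preimage_of_injective_subset_range β.injective (by simp)]

end Hamming

/-- In a sofic approximation, most points see an injective copy of any given finite set, on which
the approximation is multiplicative. -/
theorem IsSofic.exists_action {H : Type u} [Group H] (hH : IsSofic H) (S : Finset H) {δ : ℝ}
    (hδ : 0 < δ) :
    ∃ (B : Type) (_ : Fintype B) (_ : Nonempty B) (σ : H → Equiv.Perm B) (bad : Finset B),
      σ 1 = 1 ∧ (bad.card : ℝ) ≤ δ * Fintype.card B ∧
      ∀ b ∉ bad, ∀ x ∈ S, ∀ y ∈ S, (σ (x * y))⁻¹ b = (σ y)⁻¹ ((σ x)⁻¹ b) ∧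
        (x ≠ y → (σ x)⁻¹ b ≠ (σ y)⁻¹ b) := by
  classical
  -- Each pair in `S × S` spoils at most a fraction `3 * (δ / N)` of the points: one share for
  -- multiplicativity, two for injectivity. The summand `1` keeps `N` positive when `S` is empty.
  set N : ℝ := 3 * ((S.card : ℝ) * S.card) + 1 with hN
  have hN0 : 0 < N := by positivity
  obtain ⟨B, hB, hBne, σ, ⟨hσ1, hσmul⟩, hσfree⟩ :=
    hH (S ∪ Finset.image₂ (fun x y => x * y⁻¹) S S) (δ / N) (by positivity)
  have := Fintype.ofFinite B
  have hd := isBiInvariantMetric_hammingDistance (A := B)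
  have hcard : (0 : ℝ) < Fintype.card B := by exact_mod_cast Fintype.card_pos
  let bad₁ : H → H → Finset B := fun x y =>
    Finset.univ.filter fun b => (σ (x * y))⁻¹ b ≠ (σ x * σ y)⁻¹ b
  let bad₂ : H → H → Finset B := fun x y =>
    Finset.univ.filter fun b => x ≠ y ∧ (σ x)⁻¹ b = (σ y)⁻¹ b
  have hbad₁ : ∀ x ∈ S, ∀ y ∈ S, ((bad₁ x y).card : ℝ) ≤ δ / N * Fintype.card B := by
    intro x hx y hy
    have h := (hσmul x (Finset.mem_union_left _ hx) y (Finset.mem_union_left _ hy)).le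
    rw [← hd.inv_inv_eq, hammingDistance_eq, div_le_iff₀ hcard] at h
    exact h
  have hbad₂ : ∀ x ∈ S, ∀ y ∈ S, ((bad₂ x y).card : ℝ) ≤ 2 * (δ / N) * Fintype.card B := by
    intro x hx y hy
    by_cases hxy : x = y
    · have : bad₂ x y = ∅ := by simp [bad₂, hxy]
      rw [this, Finset.card_empty, Nat.cast_zero]
      positivity
    -- Since `σ (x * y⁻¹) * σ y` is close to `σ x`, the distance of `σ x` and `σ y` is almost that
    -- of `σ (x * y⁻¹)` from `1`, hence almost `1`. Passing to inverses does not change it.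
    · have hz : x * y⁻¹ ∈ S ∪ Finset.image₂ (fun x y => x * y⁻¹) S S :=
        Finset.mem_union_right _ (Finset.mem_image₂_of_mem hx hy)
      have h₁ := hσmul _ hz y (Finset.mem_union_left _ hy)
      have h₂ := hσfree _ hz (by simpa [mul_inv_eq_one] using hxy)
      rw [inv_mul_cancel_right] at h₁
      have h₃ := hd.triangle (σ (x * y⁻¹)) (σ x * (σ y)⁻¹) 1
      have h₄ : hammingDistance (σ (x * y⁻¹)) (σ x * (σ y)⁻¹) =
          hammingDistance (σ x) (σ (x * y⁻¹) * σ y) := by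
        rw [← hd.mul_right_eq _ _ (σ y), inv_mul_cancel_right, hd.symm]
      rw [h₄, ← hd.eq_mul_inv_one, ← hd.inv_inv_eq (σ x) (σ y)] at h₃
      have h₅ : 1 - 2 * (δ / N) ≤ hammingDistance (σ x)⁻¹ (σ y)⁻¹ := by linarith
      rw [hammingDistance_eq, le_div_iff₀ hcard] at h₅
      have h₆ : (bad₂ x y).card +
          (Finset.univ.filter fun b => (σ x)⁻¹ b ≠ (σ y)⁻¹ b).card = Fintype.card B := by
        have : bad₂ x y = Finset.univ.filter fun b => (σ x)⁻¹ b = (σ y)⁻¹ b := by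
          simp [bad₂, hxy]
        rw [this, Finset.card_filter_add_card_filter_not, Finset.card_univ]
      have h₇ : ((bad₂ x y).card : ℝ) +
          ((Finset.univ.filter fun b => (σ x)⁻¹ b ≠ (σ y)⁻¹ b).card : ℝ) = Fintype.card B := by
        exact_mod_cast h₆
      linarith
  refine ⟨B, inferInstance, hBne, σ,
    (S ×ˢ S).biUnion fun p => bad₁ p.1 p.2 ∪ bad₂ p.1 p.2, hσ1, ?_, ?_⟩
  · have h₁ : (((S ×ˢ S).biUnion fun p => bad₁ p.1 p.2 ∪ bad₂ p.1 p.2).card : ℝ) ≤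
        ∑ p ∈ S ×ˢ S, ((bad₁ p.1 p.2 ∪ bad₂ p.1 p.2).card : ℝ) := by
      exact_mod_cast Finset.card_biUnion_le
    have h₂ : ∀ p ∈ S ×ˢ S, ((bad₁ p.1 p.2 ∪ bad₂ p.1 p.2).card : ℝ) ≤
        3 * (δ / N) * Fintype.card B := by
      intro p hp
      obtain ⟨hp₁, hp₂⟩ := Finset.mem_product.1 hp
      have h : ((bad₁ p.1 p.2 ∪ bad₂ p.1 p.2).card : ℝ) ≤
          (bad₁ p.1 p.2).card + (bad₂ p.1 p.2).card := by
        exact_mod_cast Finset.card_union_le _ _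
      linarith [hbad₁ _ hp₁ _ hp₂, hbad₂ _ hp₁ _ hp₂]
    have h₃ := h₁.trans (Finset.sum_le_sum h₂)
    rw [Finset.sum_const, nsmul_eq_mul, Finset.card_product, Nat.cast_mul] at h₃
    refine h₃.trans ?_
    have h₄ : (S.card : ℝ) * S.card * (3 * (δ / N) * Fintype.card B) =
        (3 * ((S.card : ℝ) * S.card) / N) * (δ * Fintype.card B) := by ring
    rw [h₄]
    exact mul_le_of_le_one_left (by positivity) (div_le_one_of_le₀ (by linarith) hN0.le)
  · intro b hb x hx y hy
    have h : b ∉ bad₁ x y ∪ bad₂ x y := fun h =>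
      hb (Finset.mem_biUnion.2 ⟨(x, y), Finset.mem_product.2 ⟨hx, hy⟩, h⟩)
    simp only [bad₁, bad₂, Finset.mem_union, Finset.mem_filter, Finset.mem_univ, true_and,
      not_or, not_not, not_and, mul_inv_rev, Equiv.Perm.mul_apply] at h
    exact ⟨h.1, h.2⟩

/-! ### Copying finitely supported functions along orbits -/

section Window

variable {G H K B : Type*} [One K]

open Classical in
/-- The function on `B` obtained by copying `θ ∘ g` on the window `E` to the orbit of `b`. -/
noncomputable def windowMap (σ : H → Equiv.Perm B) (θ : G → K) (E : Finset H) (b : B)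
    (g : H → G) (β : B) : K :=
  if h : ∃ x ∈ E, (σ x)⁻¹ b = β then θ (g h.choose) else 1

variable {σ : H → Equiv.Perm B} {θ : G → K} {E : Finset H} {b : B}

theorem windowMap_apply (hE : ∀ x ∈ E, ∀ y ∈ E, x ≠ y → (σ x)⁻¹ b ≠ (σ y)⁻¹ b) (g : H → G)
    {x : H} (hx : x ∈ E) : windowMap σ θ E b g ((σ x)⁻¹ b) = θ (g x) := by
  have h : ∃ y ∈ E, (σ y)⁻¹ b = (σ x)⁻¹ b := ⟨x, hx, rfl⟩
  rw [windowMap, dif_pos h]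
  congr 2
  by_contra hne
  exact hE _ h.choose_spec.1 _ hx hne h.choose_spec.2

theorem windowMap_of_forall_ne (g : H → G) {β : B} (hβ : ∀ x ∈ E, (σ x)⁻¹ b ≠ β) :
    windowMap σ θ E b g β = 1 :=
  dif_neg fun ⟨x, hx, hxβ⟩ => hβ x hx hxβ

theorem windowMap_one [One G] (hθ : θ 1 = 1) (E : Finset H) (b : B) :
    windowMap σ θ E b (1 : H → G) = 1 := by
  funext β
  unfold windowMap
  split_ifs
  exacts [hθ, rfl]

/-- Translating the function by `h` amounts to translating the base point. -/
theorem windowMap_translate [One G] [Group H] (hθ : θ 1 = 1) {E₀ : Finset H} (hE₀ : E₀ ⊆ E) {h : H}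
    (hE : ∀ x ∈ E, ∀ y ∈ E, x ≠ y → (σ x)⁻¹ b ≠ (σ y)⁻¹ b)
    (hE' : ∀ x ∈ E, ∀ y ∈ E, x ≠ y → (σ x)⁻¹ ((σ h)⁻¹ b) ≠ (σ y)⁻¹ ((σ h)⁻¹ b))
    (hmul : ∀ y ∈ E₀, h * y ∈ E ∧ (σ (h * y))⁻¹ b = (σ y)⁻¹ ((σ h)⁻¹ b))
    {g : H → G} (hg : ∀ x ∉ E₀, g x = 1) :
    windowMap σ θ E ((σ h)⁻¹ b) g = windowMap σ θ E b fun x => g (h⁻¹ * x) := by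
  funext β
  by_cases hβ : ∃ y ∈ E₀, (σ y)⁻¹ ((σ h)⁻¹ b) = β
  · obtain ⟨y, hy, rfl⟩ := hβ
    rw [windowMap_apply hE' g (hE₀ hy), ← (hmul y hy).2, windowMap_apply hE _ (hmul y hy).1,
      inv_mul_cancel_left]
  · push Not at hβ
    -- Off the copy of the support `E₀` both sides are `1`: either `β` lies outside the relevant
    -- window and the default value applies, or it lies inside and the value is `θ 1`.
    trans 1
    · by_cases h' : ∃ y ∈ E, (σ y)⁻¹ ((σ h)⁻¹ b) = β
      · obtain ⟨y, hy, rfl⟩ := h'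
        rw [windowMap_apply hE' g hy, hg y fun hy' => hβ y hy' rfl, hθ]
      · push Not at h'
        exact windowMap_of_forall_ne g h'
    · by_cases h' : ∃ x ∈ E, (σ x)⁻¹ b = β
      · obtain ⟨x, hx, rfl⟩ := h'
        rw [windowMap_apply hE _ hx, hg, hθ]
        intro hx'
        refine hβ _ hx' ?_
        rw [← (hmul _ hx').2, mul_inv_cancel_left]
      · push Not at h'
        exact (windowMap_of_forall_ne _ h').symm

end Window

/-! ### Averages over good and bad points -/

section Average

variable {B I : Type*} [Fintype B] [Fintype I] {bad : Finset B} {η : ℝ}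

theorem sum_prod_le (hη : 0 ≤ η) (hbad : (bad.card : ℝ) ≤ η * Fintype.card B) (f : B × I → ℝ)
    (hf₁ : ∀ x, f x ≤ 1) (hf : ∀ b ∉ bad, ∀ i, f (b, i) ≤ η) :
    ∑ x, f x ≤ 2 * η * Fintype.card (B × I) := by
  classical
  have h : ∀ x : B × I, f x ≤ (if x.1 ∈ bad then 1 else 0) + η := by
    rintro ⟨b, i⟩
    split_ifs with hb
    · linarith [hf₁ (b, i)]
    · linarith [hf b hb i]
  refine (Finset.sum_le_sum fun x _ => h x).trans ?_
  rw [Finset.sum_add_distrib, Fintype.sum_prod_type]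
  have h' : ∑ b : B, ∑ _i : I, (if b ∈ bad then (1 : ℝ) else 0) =
      bad.card * Fintype.card I := by
    simp
  rw [h', Finset.sum_const, Finset.card_univ, nsmul_eq_mul, Fintype.card_prod, Nat.cast_mul]
  nlinarith [(Nat.cast_nonneg (Fintype.card I) : (0 : ℝ) ≤ _)]

theorem le_sum_prod (hbad : (bad.card : ℝ) ≤ η * Fintype.card B) {c : ℝ} (hc : 0 ≤ c)
    (f : B × I → ℝ) (hf₀ : ∀ x, 0 ≤ f x)
    (hf : ∀ b ∉ bad, c * Fintype.card I ≤ ∑ i, f (b, i)) :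
    (1 - η) * c * Fintype.card (B × I) ≤ ∑ x, f x := by
  classical
  have h : ∀ b : B, c * Fintype.card I - (if b ∈ bad then c * Fintype.card I else 0) ≤
      ∑ i, f (b, i) := by
    intro b
    split_ifs with hb
    · rw [sub_self]
      exact Finset.sum_nonneg fun i _ => hf₀ _
    · rw [sub_zero]
      exact hf b hb
  rw [Fintype.sum_prod_type]
  refine le_trans ?_ (Finset.sum_le_sum fun b _ => h b)
  rw [Finset.sum_sub_distrib]
  simp only [Finset.sum_const, Finset.card_univ, nsmul_eq_mul, Finset.sum_ite_mem,
    Finset.univ_inter, Fintype.card_prod, Nat.cast_mul]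
  have : 0 ≤ c * Fintype.card I := by positivity
  nlinarith

end Average

/-! ### The approximate homomorphism on the wreath product -/

/-- Approximate homomorphisms from the wreath product `G ≀ H`, for sofic `H`, to permutational
wreath products: an approximate homomorphism `θ` from `G` to `K` is combined with homomorphisms
`ρ i` from a power of `K` to `L`. -/
theorem IsSofic.exists_wreath_map {G : Type*} {H : Type*} [Group G] [Group H] (hH : IsSofic H)
    (F : Finset (restrictedWreathProduct G H)) {η : ℝ} (hη : 0 < η) :
    ∃ (FG : Finset G) (ε : ℝ) (B : Type) (_ : Fintype B) (_ : DecidableEq B) (_ : Nonempty B),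
      0 < ε ∧ (∀ w ∈ F, ∀ x, w.1.left x ∈ FG) ∧
      ∀ {K L : Type v} [Group K] [Group L] {d : K → K → ℝ} {d' : L → L → ℝ}
        (_ : IsBiInvariantMetric d) (_ : IsBiInvariantMetric d') (θ : G → K)
        (_ : IsMultiplicative FG ε d θ) {I : Type} [Fintype I] [Nonempty I]
        (ρ : I → (B → K) →* L) (_ : ∀ i β a, d' (ρ i (Pi.mulSingle β a)) 1 ≤ d a 1)
        (c : ℝ) (_ : 0 ≤ c) (_ : ∀ u β, c * Fintype.card I * min (d (u β) 1) 1 ≤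
          ∑ i, min (d' (ρ i u) 1) 1),
        ∃ Φ : restrictedWreathProduct G H → PermWreath L (B × I), Φ 1 = 1 ∧
          (∀ w ∈ F, ∀ w' ∈ F, PermWreath.wreathDist d' (Φ (w * w')) (Φ w * Φ w') ≤ 2 * η) ∧
          (∀ w ∈ F, w.1.right ≠ 1 →
            (1 - η) * Fintype.card (B × I) ≤ ((PermWreath.moved (Φ w)).card : ℝ)) ∧
          ∀ w ∈ F, w.1.right = 1 → ∀ x, w.1.left x ≠ 1 → (Φ w).right = 1 ∧
            (1 - η) * (c * min (d (θ (w.1.left x)) 1) 1) ≤ PermWreath.wreathDist d' (Φ w) 1 := by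
  classical
  let E₀ : Finset H := F.biUnion fun w => Set.Finite.toFinset w.2
  have hE₀ : ∀ w ∈ F, ∀ x ∉ E₀, w.1.left x = 1 := by
    intro w hw x hx
    by_contra h
    exact hx (Finset.mem_biUnion.2 ⟨w, hw, (Set.Finite.mem_toFinset _).2 h⟩)
  let FH : Finset H := F.image fun w => w.1.right
  have hFH : ∀ w ∈ F, w.1.right ∈ FH := fun w hw => Finset.mem_image_of_mem _ hw
  -- The window contains the supports of the elements of `F` and their translates, hence also the
  -- supports of products of two elements of `F`.
  let E : Finset H := E₀ ∪ Finset.image₂ (· * ·) FH E₀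
  have hE₀E : E₀ ⊆ E := Finset.subset_union_left
  have hFE : ∀ h ∈ FH, ∀ y ∈ E₀, h * y ∈ E := fun h hh y hy =>
    Finset.mem_union_right _ (Finset.mem_image₂_of_mem hh hy)
  let S : Finset H := insert 1 (E ∪ FH ∪ Finset.image₂ (· * ·) FH E)
  have hES : ∀ x ∈ E, x ∈ S := fun x hx => by simp [S, hx]
  have hFS : ∀ h ∈ FH, h ∈ S := fun x hx => by simp [S, hx]
  have hFES : ∀ h ∈ FH, ∀ x ∈ E, h * x ∈ S := fun h hh x hx => by
    simp only [S, Finset.mem_insert, Finset.mem_union]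
    exact Or.inr (Or.inr (Finset.mem_image₂_of_mem hh hx))
  have h1S : (1 : H) ∈ S := Finset.mem_insert_self _ _
  obtain ⟨B, hB, hBne, σ, bad, hσ1, hbad, hσ⟩ := hH.exists_action S hη
  let FG : Finset G := insert 1 ((F ×ˢ E₀).image fun p => p.1.1.left p.2)
  have hFG : ∀ w ∈ F, ∀ x, w.1.left x ∈ FG := by
    intro w hw x
    by_cases hx : x ∈ E₀
    · exact Finset.mem_insert_of_mem
        (Finset.mem_image.2 ⟨(w, x), Finset.mem_product.2 ⟨hw, hx⟩, rfl⟩)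
    · rw [hE₀ w hw x hx]
      exact Finset.mem_insert_self _ _
  -- The error of `θ` is incurred once for each point of the window, so the total stays below `η`.
  -- The set `B` is fixed before `θ` and `K`, because `L` will be a power of `K` indexed by `B`.
  refine ⟨FG, η / (E.card + 1), B, hB, Classical.decEq B, hBne, by positivity, hFG, ?_⟩
  intro K L _ _ d d' hd hd' θ ⟨hθ1, hθ⟩ I _ _ ρ hρ c hc hρc
  have hBI : (0 : ℝ) < Fintype.card (B × I) := by exact_mod_cast Fintype.card_pos
  have hinj : ∀ b ∉ bad, ∀ x ∈ E, ∀ y ∈ E, x ≠ y → (σ x)⁻¹ b ≠ (σ y)⁻¹ b :=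
    fun b hb x hx y hy => (hσ b hb x (hES x hx) y (hES y hy)).2
  -- The point `(σ h)⁻¹ b` may itself be bad. Injectivity there is inherited from `b`, by looking at
  -- `h * x` and `h * y`; this is why `S` contains the products from `FH` and `E`.
  have hinj' : ∀ b ∉ bad, ∀ h ∈ FH, ∀ x ∈ E, ∀ y ∈ E, x ≠ y →
      (σ x)⁻¹ ((σ h)⁻¹ b) ≠ (σ y)⁻¹ ((σ h)⁻¹ b) := by
    intro b hb h hh x hx y hy hxy
    rw [← (hσ b hb h (hFS h hh) x (hES x hx)).1, ← (hσ b hb h (hFS h hh) y (hES y hy)).1]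
    exact (hσ b hb _ (hFES h hh x hx) _ (hFES h hh y hy)).2 fun h' => hxy (mul_left_cancel h')
  let Φ : restrictedWreathProduct G H → PermWreath L (B × I) := fun w =>
    ⟨fun x => ρ x.2 (windowMap σ θ E x.1 w.1.left),
      Equiv.prodCongr (σ w.1.right) (Equiv.refl I)⟩
  have hΦl : ∀ w b i, (Φ w).left (b, i) = ρ i (windowMap σ θ E b w.1.left) := fun _ _ _ => rfl
  have hΦr : ∀ w b i, (Φ w).right⁻¹ (b, i) = ((σ w.1.right)⁻¹ b, i) := fun _ _ _ => rfl
  refine ⟨Φ, ?_, ?_, ?_, ?_⟩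
  · refine SemidirectProduct.ext (funext fun x => ?_) (Equiv.ext fun x => ?_)
    · change ρ x.2 (windowMap σ θ E x.1 (1 : H → G)) = 1
      rw [windowMap_one hθ1, map_one]
    · change (σ 1 x.1, x.2) = x
      rw [hσ1]
      rfl
  · intro w hw w' hw'
    rw [PermWreath.wreathDist, div_le_iff₀ hBI]
    refine sum_prod_le hη.le hbad _ (PermWreath.coordDist_le_one _ _) fun b hb i => ?_
    -- At a good point the permutations agree exactly, so only the defect of `θ` on the window
    -- remains.
    have hr : (Φ (w * w')).right⁻¹ (b, i) = (Φ w * Φ w').right⁻¹ (b, i) := by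
      rw [PermWreath.inv_right_apply, hΦr, hΦr, hΦr,
        ← (hσ b hb _ (hFS _ (hFH w hw)) _ (hFS _ (hFH w' hw'))).1]
      rfl
    rw [PermWreath.coordDist_of_eq hr, PermWreath.mul_left_apply, hΦr, hΦl, hΦl, hΦl, ← map_mul,
      windowMap_translate hθ1 hE₀E (hinj b hb) (hinj' b hb _ (hFH w hw))
        (fun y hy => ⟨hFE _ (hFH w hw) y hy,
          (hσ b hb _ (hFS _ (hFH w hw)) y (hES y (hE₀E hy))).1⟩) (hE₀ w' hw')]
    refine (min_le_left _ _).trans ?_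
    have hdist := dist_map_pi_le_sum hd hd' (ρ i) (hρ i) (E.image fun x => (σ x)⁻¹ b)
      (windowMap σ θ E b (w * w').1.left)
      (windowMap σ θ E b w.1.left * windowMap σ θ E b fun x => w'.1.left (w.1.right⁻¹ * x))
      (fun β hβ => by
        have hβ' : ∀ x ∈ E, (σ x)⁻¹ b ≠ β := fun x hx h =>
          hβ (Finset.mem_image.2 ⟨x, hx, h⟩)
        simp only [Pi.mul_apply, windowMap_of_forall_ne _ hβ', mul_one])
    refine hdist.trans ?_
    calc _ ≤ ∑ β ∈ E.image fun x => (σ x)⁻¹ b, η / (E.card + 1) := by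
          refine Finset.sum_le_sum fun β hβ => ?_
          obtain ⟨x, hx, rfl⟩ := Finset.mem_image.1 hβ
          rw [Pi.mul_apply, windowMap_apply (hinj b hb) _ hx, windowMap_apply (hinj b hb) _ hx,
            windowMap_apply (hinj b hb) _ hx]
          exact (hθ _ (hFG w hw x) _ (hFG w' hw' _)).le
      _ ≤ E.card * (η / (E.card + 1)) := by
          rw [Finset.sum_const, nsmul_eq_mul]
          have : ((E.image fun x => (σ x)⁻¹ b).card : ℝ) ≤ E.card := by
            exact_mod_cast Finset.card_image_le
          gcongr
      _ ≤ η := by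
          rw [mul_div_assoc', div_le_iff₀ (by positivity)]
          nlinarith
  · intro w hw hne
    have h := le_sum_prod (I := I) hbad zero_le_one
      (fun x => if x ∈ PermWreath.moved (Φ w) then 1 else 0)
      (fun x => by split_ifs <;> norm_num) (fun b hb => by
        have h : ∀ i : I, (b, i) ∈ PermWreath.moved (Φ w) := fun i => by
          rw [PermWreath.mem_moved, hΦr]
          intro h
          -- Injectivity of the orbit map, applied to `w.1.right` and `1`, says that a good point is
          -- moved; hence `1` was put into `S`.
          have h₂ := (hσ b hb _ (hFS _ (hFH w hw)) 1 h1S).2 hne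
          rw [hσ1] at h₂
          exact h₂ (congrArg Prod.fst h)
        simp [h])
    simpa using h
  · intro w hw h1 x hx
    have hr : (Φ w).right = 1 := by
      refine Equiv.ext fun x => ?_
      change (σ w.1.right x.1, x.2) = x
      rw [h1, hσ1]
      rfl
    refine ⟨hr, ?_⟩
    have hxE : x ∈ E := hE₀E (by_contra fun h => hx (hE₀ w hw x h))
    rw [PermWreath.wreathDist, le_div_iff₀ hBI]
    refine le_sum_prod hbad (mul_nonneg hc (le_min (hd.nonneg _ _) zero_le_one)) _
      (PermWreath.coordDist_nonneg hd' _ _) fun b hb => ?_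
    have h := hρc (windowMap σ θ E b w.1.left) ((σ x)⁻¹ b)
    rw [windowMap_apply (hinj b hb) _ hxE] at h
    have h' : ∀ i, PermWreath.coordDist d' (Φ w) 1 (b, i) =
        min (d' (ρ i (windowMap σ θ E b w.1.left)) 1) 1 := fun i => by
      rw [PermWreath.coordDist_of_eq (by rw [hr]; rfl)]
      rfl
    simp only [h']
    linarith

/-! ### The general permanence theorem -/

namespace PermWreath

variable {K : Type*} [Group K] {X : Type*} [Fintype X] {d : K → K → ℝ}

theorem card_moved_le (hd : IsBiInvariantMetric d) (p : PermWreath K X) :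
    ((moved p).card : ℝ) ≤ ∑ x, coordDist d p 1 x := by
  calc ((moved p).card : ℝ) = ∑ x ∈ moved p, coordDist d p 1 x := by
        rw [Finset.sum_congr rfl fun x hx => coordDist_of_ne (mem_moved.1 hx)]
        simp
    _ ≤ _ := Finset.sum_le_sum_of_subset_of_nonneg (Finset.subset_univ _)
        fun x _ _ => coordDist_nonneg hd p 1 x

end PermWreath

/-- A class of groups with bi-invariant metrics is closed under permutational wreath products if
these, for all of its members, have homomorphisms to members of the class that do not distort the
metric too much. -/
def IsPermWreathClosed (𝒞 : Set BiInvariantMetricGroup.{v}) : Prop :=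
  ∀ K ∈ 𝒞, ∀ (X : Type) [Fintype X] [Nonempty X], ∃ M ∈ 𝒞,
    ∃ ω : PermWreath K.carrier X →* M.carrier, ∀ p,
      M.dist (ω p) 1 ≤ 2 * √(PermWreath.wreathDist K.dist p 1) ∧
      (p.right = 1 → PermWreath.wreathDist K.dist p 1 ≤ M.dist (ω p) 1) ∧
      ((PermWreath.moved p).card : ℝ) ≤ 3 * Fintype.card X * M.dist (ω p) 1

theorem restrictedWreathProduct.exists_left_ne_one {G H : Type*} [Group G] [Group H]
    {w : restrictedWreathProduct G H} (hw : w ≠ 1) (h : w.1.right = 1) :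
    ∃ x, w.1.left x ≠ 1 := by
  by_contra h'
  push Not at h'
  exact hw (Subtype.ext (RegularWreathProduct.ext (funext h') h))

/-- Approximability by a class closed under tensor products and permutational wreath products
passes to wreath products with sofic groups. -/
theorem IsApproximable.restrictedWreathProduct {𝒞 : Set BiInvariantMetricGroup.{v}}
    (hT : IsTensorClosed 𝒞) (hP : IsPermWreathClosed 𝒞) {G : Type u} {H : Type w} [Group G]
    [Group H] (hH : IsSofic H) (hG : IsApproximable G 𝒞) :
    IsApproximable (restrictedWreathProduct G H) 𝒞 := by
  classical
  obtain ⟨c, hc, hG⟩ := hG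
  -- The bound may depend on `w` only, so one nontrivial coordinate of `w` is chosen once and for
  -- all. With `1 - η ≥ 1 / 2`, the constant `1 / 4` also accounts for the half lost in random
  -- restriction, and `1 / 6` for the factor `3` in `IsPermWreathClosed`.
  refine ⟨fun w => if h : w.1.right = 1 ∧ ∃ x, w.1.left x ≠ 1 then
    1 / 4 * min (c (w.1.left h.2.choose)) 1 else 1 / 6, fun w hw => ?_, fun F ε hε => ?_⟩
  · dsimp only
    split_ifs with h
    · have := hc _ h.2.choose_spec
      positivity
    · norm_num
  -- The representation turns an error `2 * η` into at most `2 * √(2 * η)`, which has to be less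
  -- than `ε`.
  set η : ℝ := min (1 / 2) (ε ^ 2 / 16) with hη
  have hη0 : 0 < η := by positivity
  have hη₁ : η ≤ 1 / 2 := min_le_left _ _
  have hη₂ : η ≤ ε ^ 2 / 16 := min_le_right _ _
  obtain ⟨FG, ε', B, _, _, _, hε', hFG, hmap⟩ := hH.exists_wreath_map F hη0
  obtain ⟨K, hK, θ, hθ, hθc⟩ := hG FG ε' hε'
  obtain ⟨L, hL, τ, hτ⟩ := hT.exists_power hK B
  have hd := K.isBiInvariantMetric
  have hd' := L.isBiInvariantMetric
  obtain ⟨Φ, hΦ1, hΦmul, hΦmoved, hΦinj⟩ := hmap hd hd' θ hθ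
    (fun S : Finset B => τ.comp (piRestrict K.carrier S))
    (fun S => dist_map_piRestrict_mulSingle_le hd hd' τ hτ S) (1 / 2) (by norm_num)
    (half_min_le_sum_piRestrict hd' τ hτ)
  obtain ⟨M, hM, ω, hω⟩ := hP L hL (B × Finset B)
  refine ⟨M, hM, fun w => ω (Φ w), ⟨?_, fun w hw w' hw' => ?_⟩, fun w hw hne => ?_⟩
  · dsimp only
    rw [hΦ1, map_one]
  · rw [← map_mul, M.dist_map_eq]
    refine (hω _).1.trans_lt ?_
    rw [← (PermWreath.isBiInvariantMetric_wreathDist hd').eq_mul_inv_one]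
    calc 2 * √(PermWreath.wreathDist L.dist (Φ (w * w')) (Φ w * Φ w'))
        ≤ 2 * √(2 * η) := by
          gcongr
          exact hΦmul w hw w' hw'
      _ < 2 * (ε / 2) := by
          gcongr
          rw [Real.sqrt_lt' (by positivity)]
          nlinarith
      _ = ε := by ring
  · dsimp only
    split_ifs with h
    · obtain ⟨hr, hle⟩ := hΦinj w hw h.1 _ h.2.choose_spec
      refine le_trans ?_ (hle.trans ((hω _).2.1 hr))
      have h₁ := hθc _ (hFG w hw h.2.choose) h.2.choose_spec
      have h₂ : min (c (w.1.left h.2.choose)) 1 ≤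
          min (K.dist (θ (w.1.left h.2.choose)) 1) 1 := min_le_min_right _ h₁
      have h₃ : 0 ≤ min (c (w.1.left h.2.choose)) 1 :=
        le_min (hc _ h.2.choose_spec).le zero_le_one
      nlinarith
    · have hr : w.1.right ≠ 1 := fun hr =>
        h ⟨hr, restrictedWreathProduct.exists_left_ne_one hne hr⟩
      have h₁ := (hΦmoved w hw hr).trans (hω (Φ w)).2.2
      have h₂ : (0 : ℝ) < Fintype.card (B × Finset B) := by exact_mod_cast Fintype.card_pos
      have h₃ : (1 - η) ≤ 3 * M.dist (ω (Φ w)) 1 := by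
        refine le_of_mul_le_mul_right ?_ h₂
        linarith
      linarith

/-! ### Weakly sofic groups -/

section WeaklySofic

theorem isTensorClosed_finite :
    IsTensorClosed {K : BiInvariantMetricGroup.{v} | Finite K.carrier} := by
  intro K hK L hL
  have hK' : Finite K.carrier := hK
  have hL' : Finite L.carrier := hL
  have hd := K.isBiInvariantMetric
  have hd' := L.isBiInvariantMetric
  refine ⟨⟨K.carrier × L.carrier, fun x y => K.dist x.1 y.1 + L.dist x.2 y.2, ?_⟩,
    (inferInstance : Finite (K.carrier × L.carrier)), MonoidHom.id _, fun a => ?_, fun b => ?_⟩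
  · refine ⟨fun x y => ?_, fun x y => ?_, fun x y z => ?_, fun a x y b => ?_⟩
    · rw [add_eq_zero_iff_of_nonneg (hd.nonneg _ _) (hd'.nonneg _ _), hd.eq_zero_iff,
        hd'.eq_zero_iff, Prod.ext_iff]
    · rw [hd.symm, hd'.symm]
    · linarith [hd.triangle x.1 y.1 z.1, hd'.triangle x.2 y.2 z.2]
    · simp only [Prod.fst_mul, Prod.snd_mul, hd.bi_invariant, hd'.bi_invariant]
  · change K.dist a 1 + L.dist 1 1 = _
    rw [hd'.self_eq_zero, add_zero]
  · change K.dist 1 1 + L.dist b 1 = _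
    rw [hd.self_eq_zero, zero_add]

theorem isPermWreathClosed_finite :
    IsPermWreathClosed {K : BiInvariantMetricGroup.{v} | Finite K.carrier} := by
  intro K hK X _ _
  have hK' : Finite K.carrier := hK
  have hd := K.isBiInvariantMetric
  have hX : (0 : ℝ) < Fintype.card X := by exact_mod_cast Fintype.card_pos
  refine ⟨⟨PermWreath K.carrier X, PermWreath.wreathDist K.dist,
    PermWreath.isBiInvariantMetric_wreathDist hd⟩,
    (inferInstance : Finite (PermWreath K.carrier X)), MonoidHom.id _, fun p => ?_⟩
  change PermWreath.wreathDist K.dist p 1 ≤ _ ∧ (_ → _ ≤ PermWreath.wreathDist K.dist p 1) ∧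
    _ ≤ _ * PermWreath.wreathDist K.dist p 1
  have h₀ := (PermWreath.isBiInvariantMetric_wreathDist hd).nonneg p (1 : PermWreath _ X)
  have h₁ := PermWreath.wreathDist_le_one (d := K.dist) p 1
  refine ⟨?_, fun _ => le_rfl, ?_⟩
  · have h₂ : PermWreath.wreathDist K.dist p 1 ≤ √(PermWreath.wreathDist K.dist p 1) :=
      Real.le_sqrt_of_sq_le (by nlinarith)
    linarith
  · refine (PermWreath.card_moved_le hd p).trans ?_
    have h₂ : ∑ x, PermWreath.coordDist K.dist p 1 x =
        Fintype.card X * PermWreath.wreathDist K.dist p 1 := by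
      rw [PermWreath.wreathDist, mul_div_cancel₀ _ hX.ne']
    rw [h₂]
    nlinarith

theorem IsWeaklySofic.restrictedWreathProduct {G : Type u} {H : Type w} [Group G] [Group H]
    (hH : IsSofic H) (hG : IsWeaklySofic G) : IsWeaklySofic (restrictedWreathProduct G H) :=
  IsApproximable.restrictedWreathProduct isTensorClosed_finite isPermWreathClosed_finite hH hG

end WeaklySofic

/-! ### Sofic groups -/

section Sofic

/-- The product action of a power of a symmetric group. -/
def permPiHom (B A : Type*) : (B → Equiv.Perm A) →* Equiv.Perm (B → A) where
  toFun u := Equiv.piCongrRight u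
  map_one' := rfl
  map_mul' _ _ := rfl

theorem ncard_eval_preimage_div_card {B A : Type*} [Finite B] [Finite A] [Nonempty A]
    (β : B) (M : Set A) :
    (({φ : B → A | φ β ∈ M}.ncard : ℝ)) / Nat.card (B → A) = (M.ncard : ℝ) / Nat.card A := by
  classical
  have := Fintype.ofFinite B
  have h : {φ : B → A | φ β ∈ M} =
      (Equiv.funSplitAt β A) ⁻¹' (M ×ˢ (Set.univ : Set ({j // j ≠ β} → A))) := by
    ext φ
    simp
  rw [h, Set.ncard_preimage_of_injective_subset_range (Equiv.funSplitAt β A).injective (by simp),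
    Set.ncard_prod, Set.ncard_univ, Nat.card_congr (Equiv.funSplitAt β A), Nat.card_prod,
    Nat.cast_mul, Nat.cast_mul]
  refine mul_div_mul_right _ _ ?_
  exact_mod_cast Nat.card_pos.ne'

theorem hammingDistance_permPiHom_mulSingle {B A : Type*} [DecidableEq B] [Finite B] [Finite A]
    [Nonempty A] (β : B) (a : Equiv.Perm A) :
    hammingDistance (permPiHom B A (Pi.mulSingle β a)) 1 = hammingDistance a 1 := by
  rw [hammingDistance, hammingDistance, ← ncard_eval_preimage_div_card (A := A) β]
  refine congrArg (fun s : Set (B → A) => (s.ncard : ℝ) / Nat.card (B → A)) (Set.ext fun φ => ?_)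
  change (fun γ => (Pi.mulSingle β a : B → Equiv.Perm A) γ (φ γ)) ≠ φ ↔ a (φ β) ≠ φ β
  rw [not_iff_not, funext_iff]
  constructor
  · intro h
    simpa using h β
  · intro h γ
    by_cases hγ : γ = β
    · subst hγ; simpa using h
    · simp [hγ]

/-- A point of `B → A` fixed by the product action is fixed in every coordinate, so coordinates
cannot cancel. This replaces random restriction and loses no constant. -/
theorem le_hammingDistance_permPiHom {B A : Type*} [Finite B] [Finite A] [Nonempty A]
    (u : B → Equiv.Perm A) (β : B) :
    hammingDistance (u β) 1 ≤ hammingDistance (permPiHom B A u) 1 := by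
  rw [hammingDistance, hammingDistance, ← ncard_eval_preimage_div_card (A := A) β]
  refine div_le_div_of_nonneg_right ?_ (Nat.cast_nonneg _)
  refine Nat.cast_le.2 (Set.ncard_le_ncard (fun φ hφ h => hφ ?_) (Set.toFinite _))
  exact congrFun h β

/-- The imprimitive action of a permutational wreath product of symmetric groups. -/
def permWreathHom (A X : Type*) : PermWreath (Equiv.Perm A) X →* Equiv.Perm (X × A) :=
  MonoidHom.toHomPerm
    { toFun := fun p y => (p.right y.1, p.left (p.right y.1) y.2)
      map_one' := rfl
      map_mul' := fun p q => by
        funext y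
        refine Prod.ext rfl ?_
        change (p * q).left (p.right (q.right y.1)) y.2 = _
        rw [PermWreath.mul_left_apply, Equiv.Perm.inv_def, Equiv.symm_apply_apply]
        rfl }

theorem permWreathHom_apply {A X : Type*} (p : PermWreath (Equiv.Perm A) X) (y : X × A) :
    permWreathHom A X p y = (p.right y.1, p.left (p.right y.1) y.2) := rfl

theorem hammingDistance_le_one {A : Type*} [Finite A] (π τ : Equiv.Perm A) :
    hammingDistance π τ ≤ 1 := by
  refine div_le_one_of_le₀ ?_ (Nat.cast_nonneg _)
  exact_mod_cast Set.ncard_le_card _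

/-- Over a moved `x` the whole fibre is displaced; over a fixed `x` the displaced fraction is the
Hamming distance of `p.left x` from `1`, which the truncation does not affect. -/
theorem hammingDistance_permWreathHom {A X : Type*} [Finite A] [Nonempty A] [Fintype X]
    (p : PermWreath (Equiv.Perm A) X) :
    hammingDistance (permWreathHom A X p) 1 = PermWreath.wreathDist hammingDistance p 1 := by
  classical
  have := Fintype.ofFinite A
  have hA : (Fintype.card A : ℝ) ≠ 0 := by exact_mod_cast Fintype.card_ne_zero
  have h : ∀ x, ∑ a, (if permWreathHom A X p (x, a) ≠ (1 : Equiv.Perm (X × A)) (x, a) then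
      (1 : ℝ) else 0) =
      PermWreath.coordDist hammingDistance p 1 x * Fintype.card A := by
    intro x
    by_cases hx : p.right⁻¹ x = x
    · have hx' : p.right x = x := by
        rw [Equiv.Perm.inv_eq_iff_eq] at hx
        exact hx.symm
      rw [PermWreath.coordDist_of_eq (by simpa using hx), min_eq_left (hammingDistance_le_one _ _),
        hammingDistance_eq, div_mul_cancel₀ _ hA, Finset.card_filter]
      push_cast
      refine Finset.sum_congr rfl fun a _ => ?_
      rw [permWreathHom_apply, hx']
      exact if_congr (by simp) rfl rfl
    · have hx' : p.right x ≠ x := fun h => hx (by rw [Equiv.Perm.inv_eq_iff_eq, h])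
      rw [PermWreath.coordDist_of_ne (by simpa using hx), one_mul,
        Finset.sum_congr rfl fun a _ => if_pos (by
          rw [permWreathHom_apply]
          exact fun h => hx' (congrArg Prod.fst h))]
      simp
  rw [hammingDistance_eq, PermWreath.wreathDist, Finset.natCast_card_filter,
    Fintype.sum_prod_type, Finset.sum_congr rfl fun x _ => h x, ← Finset.sum_mul,
    Fintype.card_prod, Nat.cast_mul, mul_div_mul_right _ _ hA]

theorem IsSofic.restrictedWreathProduct {G : Type u} {H : Type w} [Group G] [Group H]
    (hH : IsSofic H) (hG : IsSofic G) : IsSofic (restrictedWreathProduct G H) := by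
  intro F ε hε
  -- Multiplicativity needs `2 * η < ε`. Freeness on the base group needs `(1 - η) ^ 2 > 1 - ε`, one
  -- factor for the bad points and one for the defect of `θ`.
  set η : ℝ := min (1 / 2) (ε / 3) with hη
  have hη0 : 0 < η := by positivity
  have hη₁ : η ≤ 1 / 2 := min_le_left _ _
  have hη₂ : η ≤ ε / 3 := min_le_right _ _
  obtain ⟨FG, ε', B, _, _, _, hε', hFG, hmap⟩ := hH.exists_wreath_map F hη0
  obtain ⟨A, _, _, θ, hθ, hθfree⟩ := hG FG (min ε' η) (by positivity)
  have hd := isBiInvariantMetric_hammingDistance (A := A)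
  have hd' := isBiInvariantMetric_hammingDistance (A := B → A)
  obtain ⟨Φ, hΦ1, hΦmul, hΦmoved, hΦinj⟩ := hmap hd hd' θ
    ⟨hθ.1, fun g hg h hh => (hθ.2 g hg h hh).trans_le (min_le_left _ _)⟩
    (fun _ : Unit => permPiHom B A) (fun _ β a => (hammingDistance_permPiHom_mulSingle β a).le)
    1 zero_le_one (fun u β => by
      simpa using Or.inl (le_hammingDistance_permPiHom u β))
  have hX : (0 : ℝ) < Fintype.card (B × Unit) := by exact_mod_cast Fintype.card_pos
  have hW := PermWreath.isBiInvariantMetric_wreathDist (X := B × Unit) hd'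
  have hω := isBiInvariantMetric_hammingDistance (A := (B × Unit) × (B → A))
  refine ⟨(B × Unit) × (B → A), inferInstance, inferInstance,
    fun w => permWreathHom _ _ (Φ w), ⟨?_, fun w hw w' hw' => ?_⟩, fun w hw hne => ?_⟩
  · dsimp only
    rw [hΦ1, map_one]
  · rw [← map_mul, hω.eq_mul_inv_one, ← map_inv, ← map_mul, hammingDistance_permWreathHom,
      ← hW.eq_mul_inv_one]
    linarith [hΦmul w hw w' hw']
  · rw [hammingDistance_permWreathHom]
    by_cases hr : w.1.right = 1
    · obtain ⟨x, hx⟩ := restrictedWreathProduct.exists_left_ne_one hne hr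
      refine lt_of_lt_of_le ?_ (hΦinj w hw hr x hx).2
      have h₁ := hθfree _ (hFG w hw x) hx
      have h₂ : 1 - η ≤ min (hammingDistance (θ (w.1.left x)) 1) 1 :=
        le_min (by linarith [min_le_right ε' η]) (by linarith)
      nlinarith
    · have h₁ := (hΦmoved w hw hr).trans (PermWreath.card_moved_le hd' (Φ w))
      rw [← le_div_iff₀ hX] at h₁
      refine lt_of_lt_of_le ?_ h₁
      linarith

end Sofic

open scoped Kronecker

/-! ### Ranks of block diagonal and Kronecker matrices -/

section Rank

variable {𝔽 : Type w} [Field 𝔽] {m X : Type*} [Fintype m] [DecidableEq m] [Fintype X]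
  [DecidableEq X]

theorem rank_add_le_of_field {ι : Type*} [Fintype ι] (A B : Matrix ι ι 𝔽) :
    (A + B).rank ≤ A.rank + B.rank := by
  rw [Matrix.rank, Matrix.rank, Matrix.rank, Matrix.mulVecLin_add]
  exact (Submodule.finrank_mono (LinearMap.range_add_le _ _)).trans
    (Submodule.finrank_add_le_finrank_add_finrank _ _)

theorem rank_neg_of_field (A : Matrix m m 𝔽) : (-A).rank = A.rank := by
  have h : (-A).mulVecLin = -A.mulVecLin := by
    ext
    simp
  rw [Matrix.rank, Matrix.rank, h, LinearMap.range_neg]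

theorem exists_isUnit_mul_mul_eq_diagonal (M : Matrix m m 𝔽) :
    ∃ (V U : Matrix m m 𝔽) (d : m → 𝔽), IsUnit V ∧ IsUnit U ∧ V * M * U = Matrix.diagonal d := by
  obtain ⟨V, U, e, hV, hU, h⟩ := M.exists_rank_normal_form
  refine ⟨V, U, (Sum.elim (fun _ => 1) fun _ => 0) ∘ e, hV, hU, ?_⟩
  rw [h, ← Matrix.submatrix_diagonal_equiv, ← Matrix.fromBlocks_diagonal, Matrix.diagonal_one,
    Matrix.diagonal_zero]

theorem rank_mul_mul_of_isUnit {V U : Matrix m m 𝔽} (hV : IsUnit V) (hU : IsUnit U)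
    (M : Matrix m m 𝔽) : (V * M * U).rank = M.rank := by
  rw [Matrix.rank_mul_eq_left_of_isUnit_det _ _ ((Matrix.isUnit_iff_isUnit_det _).1 hU),
    Matrix.rank_mul_eq_right_of_isUnit_det _ _ ((Matrix.isUnit_iff_isUnit_det _).1 hV)]

/-- Multiplying by invertible block diagonal matrices brings every block into diagonal form, where
the rank counts nonzero entries. -/
theorem rank_blockDiagonal (M : X → Matrix m m 𝔽) :
    (Matrix.blockDiagonal M).rank = ∑ x, (M x).rank := by
  classical
  choose V U d hV hU h using fun x => exists_isUnit_mul_mul_eq_diagonal (M x)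
  have hV' : IsUnit (Matrix.blockDiagonal V) :=
    (Pi.isUnit_iff.2 hV).map (Matrix.blockDiagonalRingHom m X 𝔽)
  have hU' : IsUnit (Matrix.blockDiagonal U) :=
    (Pi.isUnit_iff.2 hU).map (Matrix.blockDiagonalRingHom m X 𝔽)
  have h' : Matrix.blockDiagonal V * Matrix.blockDiagonal M * Matrix.blockDiagonal U =
      Matrix.diagonal fun a => d a.2 a.1 := by
    rw [← Matrix.blockDiagonal_mul, ← Matrix.blockDiagonal_mul]
    simp only [h]
    exact Matrix.blockDiagonal_diagonal d
  rw [← rank_mul_mul_of_isUnit hV' hU', h', Matrix.rank_diagonal, Fintype.card_subtype,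
    Finset.card_filter, Fintype.sum_prod_type_right]
  refine Finset.sum_congr rfl fun x _ => ?_
  rw [← rank_mul_mul_of_isUnit (hV x) (hU x), h, Matrix.rank_diagonal, Fintype.card_subtype,
    Finset.card_filter]

theorem rank_kronecker_one (M : Matrix m m 𝔽) :
    (M ⊗ₖ (1 : Matrix X X 𝔽)).rank = Fintype.card X * M.rank := by
  rw [Matrix.kronecker_one, rank_blockDiagonal, Finset.sum_const, Finset.card_univ, smul_eq_mul]

theorem rank_one_kronecker (M : Matrix m m 𝔽) :
    ((1 : Matrix X X 𝔽) ⊗ₖ M).rank = Fintype.card X * M.rank := by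
  rw [Matrix.one_kronecker, Matrix.rank_reindex, rank_blockDiagonal, Finset.sum_const,
    Finset.card_univ, smul_eq_mul]

end Rank

/-! ### Tensor products of representations -/

section Kronecker

variable {R : Type*} [CommRing R] {m n : Type*} [DecidableEq m] [DecidableEq n]

theorem kronecker_one_sub_one (A : Matrix m m R) :
    A ⊗ₖ (1 : Matrix n n R) - 1 = (A - 1) ⊗ₖ (1 : Matrix n n R) := by
  rw [sub_eq_iff_eq_add, ← Matrix.one_kronecker_one, ← Matrix.add_kronecker, sub_add_cancel]

theorem one_kronecker_sub_one (B : Matrix n n R) :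
    (1 : Matrix m m R) ⊗ₖ B - 1 = (1 : Matrix m m R) ⊗ₖ (B - 1) := by
  rw [sub_eq_iff_eq_add, ← Matrix.one_kronecker_one, ← Matrix.kronecker_add, sub_add_cancel]

/-- The tensor product of two matrix representations. -/
def kroneckerHom [Fintype m] [Fintype n] {K L : Type*} [Group K] [Group L]
    (f : K →* Matrix m m R) (g : L →* Matrix n n R) :
    K × L →* Matrix (m × n) (m × n) R where
  toFun x := f x.1 ⊗ₖ g x.2
  map_one' := by simp
  map_mul' x y := by simp [Matrix.mul_kronecker_mul]

end Kronecker

/-! ### Block monomial representations -/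

section Monomial

variable {R : Type*} [CommRing R] {m X K : Type*} [Fintype m] [DecidableEq m] [Fintype X]
  [DecidableEq X] [Group K]

/-- The block monomial representation of a permutational wreath product induced by a matrix
representation. -/
def monomialHom (f : K →* Matrix m m R) : PermWreath K X →* Matrix (m × X) (m × X) R where
  toFun p := Matrix.of fun a b => if p.right⁻¹ a.2 = b.2 then f (p.left a.2) a.1 b.1 else 0
  map_one' := by
    ext ⟨i, x⟩ ⟨j, y⟩
    by_cases h : x = y <;> simp [Matrix.one_apply, h]
  map_mul' p q := by
    ext ⟨i, x⟩ ⟨j, y⟩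
    rw [Matrix.mul_apply, Fintype.sum_prod_type_right,
      Finset.sum_eq_single (p.right⁻¹ x) _ (by simp)]
    · simp only [Matrix.of_apply, if_true, PermWreath.inv_right_apply, PermWreath.mul_left_apply,
        map_mul, Matrix.mul_apply]
      split_ifs <;> simp
    · intro y' _ hy'
      refine Finset.sum_eq_zero fun k _ => ?_
      rw [Matrix.of_apply, if_neg fun h => hy' h.symm, zero_mul]

theorem monomialHom_apply (f : K →* Matrix m m R) (p : PermWreath K X) (i j : m) (x y : X) :
    monomialHom f p (i, x) (j, y) = if p.right⁻¹ x = y then f (p.left x) i j else 0 := rfl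

theorem monomialHom_sub_one_apply_of_fixed (f : K →* Matrix m m R) {p : PermWreath K X} {x : X}
    (hx : p.right⁻¹ x = x) (i j : m) (y : X) :
    (monomialHom f p - 1) (i, x) (j, y) = if x = y then (f (p.left x) - 1) i j else 0 := by
  rw [Matrix.sub_apply, monomialHom_apply, hx]
  by_cases h : x = y <;> simp [h, Matrix.one_apply]

/-- Take `Y` of maximal size among the sets disjoint from their preimage under `π`. A moved point
outside `Y` and its two translates by `π` and `π⁻¹` could be added to `Y`, so these three sets cover
all moved points. -/
theorem exists_disjoint_image (π : Equiv.Perm X) :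
    ∃ Y : Finset X, (∀ x ∈ Y, π⁻¹ x ∉ Y) ∧
      (Finset.univ.filter fun x => π⁻¹ x ≠ x).card ≤ 3 * Y.card := by
  obtain ⟨Y, hY, hmax⟩ := (Finset.univ.filter fun Y : Finset X => ∀ x ∈ Y, π⁻¹ x ∉ Y)
    |>.exists_max_image Finset.card ⟨∅, by simp⟩
  simp only [Finset.mem_filter, Finset.mem_univ, true_and] at hY hmax
  refine ⟨Y, hY, ?_⟩
  have hsub : (Finset.univ.filter fun x => π⁻¹ x ≠ x) ⊆
      Y ∪ Y.image π ∪ Y.image (π⁻¹ : Equiv.Perm X) := by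
    intro x hx
    by_contra hxY
    simp only [Finset.mem_union, not_or, Finset.mem_image, not_exists, not_and] at hxY
    obtain ⟨⟨h₁, h₂⟩, h₃⟩ := hxY
    have h := hmax (insert x Y) fun y hy => by
      rw [Finset.mem_insert, not_or]
      rcases Finset.mem_insert.1 hy with rfl | hy
      · exact ⟨(Finset.mem_filter.1 hx).2, fun h => h₂ _ h (by simp)⟩
      · exact ⟨fun h => h₃ y hy h, hY y hy⟩
    rw [Finset.card_insert_of_notMem h₁] at h
    omega
  have h₁ := Finset.card_le_card hsub
  have h₂ := Finset.card_union_le (Y ∪ Y.image π) (Y.image (π⁻¹ : Equiv.Perm X))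
  have h₃ := Finset.card_union_le Y (Y.image π)
  have h₄ := Finset.card_image_le (s := Y) (f := π)
  have h₅ := Finset.card_image_le (s := Y) (f := (π⁻¹ : Equiv.Perm X))
  omega

end Monomial

/-! ### Linear sofic groups -/

section LinearSofic

variable {𝔽 : Type w} [Field 𝔽]

theorem exists_generalLinear_hom {L ι : Type*} [Group L] [Fintype ι] [DecidableEq ι] [Nonempty ι]
    (f : L →* Matrix ι ι 𝔽) :
    ∃ M ∈ {K | ∃ (n : ℕ) (hn : 0 < n), K = generalLinearMetricGroup 𝔽 n hn},
      ∃ τ : L →* M.carrier, ∀ l, M.dist (τ l) 1 = ((f l - 1).rank : ℝ) / Fintype.card ι := by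
  let e := Fintype.equivFin ι
  let r := Matrix.reindexAlgEquiv 𝔽 𝔽 e
  refine ⟨generalLinearMetricGroup 𝔽 (Fintype.card ι) Fintype.card_pos, ⟨_, _, rfl⟩,
    MonoidHom.toHomUnits ((r : Matrix ι ι 𝔽 →* _).comp f), fun l => ?_⟩
  change (((r (f l) - 1).rank : ℝ)) / (Fintype.card ι : ℕ) = _
  rw [← map_one r, ← map_sub]
  congr 2
  exact Matrix.rank_reindex e e (f l - 1)

theorem isTensorClosed_generalLinear :
    IsTensorClosed {K | ∃ (n : ℕ) (hn : 0 < n), K = generalLinearMetricGroup 𝔽 n hn} := by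
  rintro _ ⟨n, hn, rfl⟩ _ ⟨m, hm, rfl⟩
  have := Fin.pos_iff_nonempty.1 hn
  have := Fin.pos_iff_nonempty.1 hm
  have hn' : (n : ℝ) ≠ 0 := by positivity
  have hm' : (m : ℝ) ≠ 0 := by positivity
  obtain ⟨M, hM, τ, hτ⟩ := exists_generalLinear_hom
    (kroneckerHom (Units.coeHom (Matrix (Fin n) (Fin n) 𝔽))
      (Units.coeHom (Matrix (Fin m) (Fin m) 𝔽)))
  refine ⟨M, hM, τ, fun a => (hτ _).trans ?_, fun b => (hτ _).trans ?_⟩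
  · change (((a.1 ⊗ₖ (1 : Matrix (Fin m) (Fin m) 𝔽) - 1).rank : ℝ)) / _ = ((a.1 - 1).rank : ℝ) / n
    rw [kronecker_one_sub_one, rank_kronecker_one]
    simp only [Fintype.card_prod, Fintype.card_fin, Nat.cast_mul]
    field_simp
  · change ((((1 : Matrix (Fin n) (Fin n) 𝔽) ⊗ₖ b.1 - 1).rank : ℝ)) / _ = ((b.1 - 1).rank : ℝ) / m
    rw [one_kronecker_sub_one, rank_one_kronecker]
    simp only [Fintype.card_prod, Fintype.card_fin, Nat.cast_mul]
    field_simp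

section

variable {m X K : Type*} [Fintype m] [DecidableEq m] [Fintype X] [DecidableEq X] [Group K]

theorem rank_monomialHom_sub_one_le (f : K →* Matrix m m 𝔽) (p : PermWreath K X) :
    (monomialHom f p - 1).rank ≤
      ∑ x, if p.right⁻¹ x = x then (f (p.left x) - 1).rank else Fintype.card m := by
  classical
  -- Rows over fixed points form a block diagonal matrix. The rows over moved points are cut out by
  -- a diagonal projection, whose rank bounds their contribution.
  have h : monomialHom f p - 1 =
      Matrix.blockDiagonal (fun x => if p.right⁻¹ x = x then f (p.left x) - 1 else 0) +
      Matrix.diagonal (fun a : m × X => if p.right⁻¹ a.2 = a.2 then (0 : 𝔽) else 1) *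
        (monomialHom f p - 1) := by
    ext ⟨i, x⟩ ⟨j, y⟩
    rw [Matrix.add_apply, Matrix.diagonal_mul, Matrix.blockDiagonal_apply]
    by_cases hx : p.right⁻¹ x = x
    · rw [monomialHom_sub_one_apply_of_fixed f hx]
      simp only [hx, if_true, zero_mul, add_zero]
    · simp only [hx, if_false, Matrix.zero_apply, ite_self, zero_add, one_mul]
  rw [h]
  refine (rank_add_le_of_field _ _).trans ?_
  rw [rank_blockDiagonal]
  refine (Nat.add_le_add_left (Matrix.rank_mul_le_left _ _) _).trans_eq ?_
  rw [Matrix.rank_diagonal, Fintype.card_subtype, Finset.card_filter,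
    Fintype.sum_prod_type_right, ← Finset.sum_add_distrib]
  refine Finset.sum_congr rfl fun x _ => ?_
  by_cases hx : p.right⁻¹ x = x
  · simp only [hx, if_true, ne_eq, not_true_eq_false, if_false, Finset.sum_const_zero, add_zero]
  · simp only [if_neg hx, Matrix.rank_zero, zero_add]
    simp

theorem monomialHom_sub_one_of_right_eq_one (f : K →* Matrix m m 𝔽) {p : PermWreath K X}
    (hp : p.right = 1) :
    monomialHom f p - 1 = Matrix.blockDiagonal fun x => f (p.left x) - 1 := by
  ext ⟨i, x⟩ ⟨j, y⟩
  rw [monomialHom_sub_one_apply_of_fixed f (by simp [hp]), Matrix.blockDiagonal_apply]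

/-- On a set `Y` disjoint from its translate, the monomial matrix has no entries between blocks of
`Y`. Compressing to `Y` thus leaves only minus the identity, whose rank is a lower bound. -/
theorem card_moved_mul_le_rank (f : K →* Matrix m m 𝔽) (p : PermWreath K X) :
    (PermWreath.moved p).card * Fintype.card m ≤ 3 * (monomialHom f p - 1).rank := by
  classical
  obtain ⟨Y, hY, hcard⟩ := exists_disjoint_image p.right
  have hmoved : PermWreath.moved p = Finset.univ.filter fun x => p.right⁻¹ x ≠ x := by
    ext x
    simp [PermWreath.mem_moved]
  rw [← hmoved] at hcard
  let D : Matrix (m × X) (m × X) 𝔽 := Matrix.diagonal fun a => if a.2 ∈ Y then 1 else 0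
  have hD : D * (monomialHom f p - 1) * D = -D := by
    ext ⟨i, x⟩ ⟨j, y⟩
    simp only [D, Matrix.mul_diagonal, Matrix.diagonal_mul, Matrix.sub_apply, monomialHom_apply,
      Matrix.neg_apply]
    by_cases hx : x ∈ Y
    · by_cases hy : y ∈ Y
      · have hxy : p.right⁻¹ x ≠ y := fun h => hY x hx (h ▸ hy)
        rw [if_neg hxy]
        by_cases h : ((i, x) : m × X) = (j, y)
        · obtain ⟨rfl, rfl⟩ := Prod.mk.inj h
          simp [hx]
        · simp [h, Matrix.one_apply_ne h]
      · have hxy : ((i, x) : m × X) ≠ (j, y) := fun h => hy (by cases h; exact hx)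
        simp [hy, Matrix.diagonal_apply_ne _ hxy]
    · simp [hx, Matrix.diagonal_apply]
  have hDrank : D.rank = Y.card * Fintype.card m := by
    rw [Matrix.rank_diagonal, Fintype.card_subtype, Finset.card_filter,
      Fintype.sum_prod_type_right]
    simp [Finset.sum_ite_mem]
  have h : D.rank ≤ (monomialHom f p - 1).rank := by
    rw [← rank_neg_of_field D, ← hD]
    exact (Matrix.rank_mul_le_left _ _).trans (Matrix.rank_mul_le_right _ _)
  rw [hDrank] at h
  nlinarith

end

theorem isPermWreathClosed_generalLinear :
    IsPermWreathClosed {K | ∃ (n : ℕ) (hn : 0 < n), K = generalLinearMetricGroup 𝔽 n hn} := by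
  classical
  rintro _ ⟨n, hn, rfl⟩ X _ _
  have := Fin.pos_iff_nonempty.1 hn
  have hn' : (0 : ℝ) < n := by positivity
  have hX : (0 : ℝ) < Fintype.card X := by exact_mod_cast Fintype.card_pos
  have hd := isBiInvariantMetric_rankDist 𝔽 hn
  let f : GL (Fin n) 𝔽 →* Matrix (Fin n) (Fin n) 𝔽 := Units.coeHom _
  obtain ⟨M, hM, ω, hω⟩ := exists_generalLinear_hom (monomialHom (X := X) f)
  suffices key : ∀ p : PermWreath (GL (Fin n) 𝔽) X,
      M.dist (ω p) 1 ≤ 2 * √(PermWreath.wreathDist rankDist p 1) ∧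
      (p.right = 1 → PermWreath.wreathDist rankDist p 1 ≤ M.dist (ω p) 1) ∧
      ((PermWreath.moved p).card : ℝ) ≤ 3 * Fintype.card X * M.dist (ω p) 1 from
    ⟨M, hM, ω, key⟩
  intro p
  have hcard : (Fintype.card (Fin n × X) : ℝ) = n * Fintype.card X := by
    simp [Fintype.card_prod]
  have hdist : M.dist (ω p) 1 * Fintype.card X = (monomialHom f p - 1).rank / n := by
    rw [hω, hcard]
    field_simp
  have hone : ∀ a : GL (Fin n) 𝔽, ((f a - 1).rank : ℝ) / n ≤ 1 := fun a => by
    refine div_le_one_of_le₀ ?_ hn'.le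
    exact_mod_cast Matrix.rank_le_width _
  have hcoord : ∀ x, ((if p.right⁻¹ x = x then (f (p.left x) - 1).rank else Fintype.card (Fin n) :
      ℕ) : ℝ) / n = PermWreath.coordDist rankDist p 1 x := by
    intro x
    by_cases hx : p.right⁻¹ x = x
    · rw [if_pos hx, PermWreath.coordDist_of_eq (by simpa using hx)]
      exact (min_eq_left (hone _)).symm
    · rw [if_neg hx, PermWreath.coordDist_of_ne (by simpa using hx), Fintype.card_fin,
        div_self hn'.ne']
  have hA : PermWreath.wreathDist rankDist p 1 * Fintype.card X =
      (∑ x, ((if p.right⁻¹ x = x then (f (p.left x) - 1).rank else Fintype.card (Fin n) :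
      ℕ) : ℝ)) / n := by
    rw [PermWreath.wreathDist, div_mul_cancel₀ _ hX.ne', Finset.sum_div]
    exact Finset.sum_congr rfl fun x _ => (hcoord x).symm
  refine ⟨?_, fun hp => ?_, ?_⟩
  · have h₀ := (PermWreath.isBiInvariantMetric_wreathDist hd).nonneg p (1 : PermWreath _ X)
    have h₁ := PermWreath.wreathDist_le_one (d := rankDist) p 1
    have h₂ : PermWreath.wreathDist rankDist p 1 ≤ √(PermWreath.wreathDist rankDist p 1) :=
      Real.le_sqrt_of_sq_le (by nlinarith)
    have h₃ : M.dist (ω p) 1 ≤ PermWreath.wreathDist rankDist p 1 := by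
      refine le_of_mul_le_mul_right ?_ hX
      rw [hdist, hA]
      refine div_le_div_of_nonneg_right ?_ hn'.le
      exact_mod_cast rank_monomialHom_sub_one_le f p
    linarith
  · refine le_of_mul_le_mul_right ?_ hX
    rw [hdist, hA, monomialHom_sub_one_of_right_eq_one f hp, rank_blockDiagonal, Nat.cast_sum]
    refine le_of_eq (congrArg (· / (n : ℝ)) (Finset.sum_congr rfl fun x _ => ?_))
    rw [if_pos (by simp [hp])]
  · have h : ((PermWreath.moved p).card * n : ℝ) ≤ 3 * (monomialHom f p - 1).rank := by
      have := card_moved_mul_le_rank f p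
      rw [Fintype.card_fin] at this
      exact_mod_cast this
    rw [mul_assoc, mul_comm (Fintype.card X : ℝ), hdist, mul_div_assoc', le_div_iff₀ hn']
    exact h

theorem IsLinearSofic.restrictedWreathProduct {G : Type u} {H : Type v} [Group G] [Group H]
    (hH : IsSofic H) (hG : IsLinearSofic 𝔽 G) : IsLinearSofic 𝔽 (restrictedWreathProduct G H) :=
  IsApproximable.restrictedWreathProduct isTensorClosed_generalLinear
    isPermWreathClosed_generalLinear hH hG

end LinearSofic

/-! ### Hyperlinear groups -/

section Hyperlinear

/-- The sum of the squares of the absolute values of the entries. -/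
noncomputable def sumNormSq {ι κ : Type*} [Fintype ι] [Fintype κ] (A : Matrix ι κ ℂ) : ℝ :=
  ∑ i, ∑ j, ‖A i j‖ ^ 2

theorem sumNormSq_nonneg {ι κ : Type*} [Fintype ι] [Fintype κ] (A : Matrix ι κ ℂ) :
    0 ≤ sumNormSq A :=
  Finset.sum_nonneg fun _ _ => Finset.sum_nonneg fun _ _ => sq_nonneg _

theorem trace_star_mul_self_eq {ι : Type*} [Fintype ι] (A : Matrix ι ι ℂ) :
    (A.conjTranspose * A).trace = (sumNormSq A : ℂ) := by
  rw [sumNormSq, Finset.sum_comm]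
  simp only [Matrix.trace, Matrix.diag_apply, Matrix.mul_apply, Matrix.conjTranspose_apply]
  push_cast
  exact Finset.sum_congr rfl fun i _ => Finset.sum_congr rfl fun j _ => Complex.conj_mul' _

theorem hilbertSchmidtNorm_eq_sqrt {n : ℕ} (A : Matrix (Fin n) (Fin n) ℂ) :
    hilbertSchmidtNorm A = √(sumNormSq A / n) := by
  have h : (1 / (n : ℂ)) = ((1 / (n : ℝ) : ℝ) : ℂ) := by push_cast; rfl
  rw [hilbertSchmidtNorm, normalizedTrace, trace_star_mul_self_eq, h, ← Complex.ofReal_mul,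
    Complex.ofReal_re, one_div_mul_eq_div]

theorem sumNormSq_of_mem_unitary {ι : Type*} [Fintype ι] [DecidableEq ι] {A : Matrix ι ι ℂ}
    (hA : A ∈ Matrix.unitaryGroup ι ℂ) : sumNormSq A = Fintype.card ι := by
  have h := trace_star_mul_self_eq A
  rw [← Matrix.star_eq_conjTranspose, Matrix.mem_unitaryGroup_iff'.1 hA, Matrix.trace_one] at h
  exact_mod_cast h.symm

theorem sumNormSq_kronecker {ι κ : Type*} [Fintype ι] [Fintype κ] (A : Matrix ι ι ℂ)
    (B : Matrix κ κ ℂ) : sumNormSq (A ⊗ₖ B) = sumNormSq A * sumNormSq B := by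
  simp only [sumNormSq, Fintype.sum_prod_type, Matrix.kroneckerMap_apply, norm_mul, mul_pow]
  rw [Finset.sum_mul_sum]
  refine Finset.sum_congr rfl fun i _ => Finset.sum_congr rfl fun j _ => ?_
  rw [Finset.sum_mul_sum]

theorem sumNormSq_one {ι : Type*} [Fintype ι] [DecidableEq ι] :
    sumNormSq (1 : Matrix ι ι ℂ) = Fintype.card ι :=
  sumNormSq_of_mem_unitary (one_mem _)

theorem sumNormSq_sub_one_le {ι : Type*} [Fintype ι] [DecidableEq ι] {A : Matrix ι ι ℂ}
    (hA : A ∈ Matrix.unitaryGroup ι ℂ) : sumNormSq (A - 1) ≤ 4 * Fintype.card ι := by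
  have h : sumNormSq (A - 1) ≤ 2 * sumNormSq A + 2 * sumNormSq (1 : Matrix ι ι ℂ) := by
    simp only [sumNormSq, Finset.mul_sum, ← Finset.sum_add_distrib]
    refine Finset.sum_le_sum fun i _ => Finset.sum_le_sum fun j _ => ?_
    have h := norm_sub_le (A i j) ((1 : Matrix ι ι ℂ) i j)
    rw [Matrix.sub_apply]
    nlinarith [norm_nonneg (A i j - (1 : Matrix ι ι ℂ) i j),
      sq_nonneg (‖A i j‖ - ‖(1 : Matrix ι ι ℂ) i j‖)]
  rw [sumNormSq_of_mem_unitary hA, sumNormSq_one] at h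
  linarith

theorem exists_unitary_hom {L ι : Type*} [Group L] [Fintype ι] [DecidableEq ι] [Nonempty ι]
    (f : L →* Matrix ι ι ℂ) (hf : ∀ l, f l ∈ Matrix.unitaryGroup ι ℂ) :
    ∃ M ∈ {K | ∃ (n : ℕ) (hn : 0 < n), K = unitaryMetricGroup n hn},
      ∃ τ : L →* M.carrier, ∀ l, M.dist (τ l) 1 = √(sumNormSq (f l - 1) / Fintype.card ι) := by
  let e := Fintype.equivFin ι
  let r := Matrix.reindexAlgEquiv ℂ ℂ e
  have hr : ∀ l, ((r : Matrix ι ι ℂ →* _).comp f) l ∈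
      Matrix.unitaryGroup (Fin (Fintype.card ι)) ℂ := fun l => by
    rw [Matrix.mem_unitaryGroup_iff']
    have h : star (r (f l)) = r (star (f l)) := rfl
    change star (r (f l)) * r (f l) = 1
    rw [h, ← map_mul, Matrix.mem_unitaryGroup_iff'.1 (hf l), map_one]
  refine ⟨unitaryMetricGroup (Fintype.card ι) Fintype.card_pos, ⟨_, _, rfl⟩,
    MonoidHom.codRestrict _ _ hr, fun l => ?_⟩
  change hilbertSchmidtNorm (r (f l) - 1) = _
  rw [hilbertSchmidtNorm_eq_sqrt, ← map_one r, ← map_sub]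
  congr 2
  change ∑ i, ∑ j, ‖(f l - 1) (e.symm i) (e.symm j)‖ ^ 2 = _
  rw [Equiv.sum_comp e.symm fun i => ∑ j, ‖(f l - 1) i (e.symm j)‖ ^ 2]
  exact Finset.sum_congr rfl fun i _ => Equiv.sum_comp e.symm fun j => ‖(f l - 1) i j‖ ^ 2

theorem isTensorClosed_unitary :
    IsTensorClosed {K | ∃ (n : ℕ) (hn : 0 < n), K = unitaryMetricGroup n hn} := by
  rintro _ ⟨n, hn, rfl⟩ _ ⟨m, hm, rfl⟩
  have := Fin.pos_iff_nonempty.1 hn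
  have := Fin.pos_iff_nonempty.1 hm
  have hn' : (n : ℝ) ≠ 0 := by positivity
  have hm' : (m : ℝ) ≠ 0 := by positivity
  obtain ⟨M, hM, τ, hτ⟩ := exists_unitary_hom
    (kroneckerHom (Matrix.unitaryGroup (Fin n) ℂ).subtype (Matrix.unitaryGroup (Fin m) ℂ).subtype)
    (fun l => Matrix.kronecker_mem_unitary l.1.2 l.2.2)
  refine ⟨M, hM, τ, fun a => (hτ _).trans ?_, fun b => (hτ _).trans ?_⟩
  · change √(sumNormSq (a.1 ⊗ₖ (1 : Matrix (Fin m) (Fin m) ℂ) - 1) / _) =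
      hilbertSchmidtNorm (a.1 - 1)
    rw [kronecker_one_sub_one, sumNormSq_kronecker, sumNormSq_one, hilbertSchmidtNorm_eq_sqrt]
    simp only [Fintype.card_prod, Fintype.card_fin, Nat.cast_mul]
    rw [mul_div_mul_right _ _ hm']
  · change √(sumNormSq ((1 : Matrix (Fin n) (Fin n) ℂ) ⊗ₖ b.1 - 1) / _) =
      hilbertSchmidtNorm (b.1 - 1)
    rw [one_kronecker_sub_one, sumNormSq_kronecker, sumNormSq_one, hilbertSchmidtNorm_eq_sqrt]
    simp only [Fintype.card_prod, Fintype.card_fin, Nat.cast_mul]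
    rw [mul_div_mul_left _ _ hn']

section

variable {m X K : Type*} [Fintype m] [DecidableEq m] [Fintype X] [DecidableEq X] [Group K]

theorem monomialHom_mem_unitaryGroup {f : K →* Matrix m m ℂ}
    (hf : ∀ k, f k ∈ Matrix.unitaryGroup m ℂ) (p : PermWreath K X) :
    monomialHom f p ∈ Matrix.unitaryGroup (m × X) ℂ := by
  have hinv : ∀ k, f k⁻¹ = star (f k) := fun k => by
    have h₁ : f k * f k⁻¹ = 1 := by rw [← map_mul, mul_inv_cancel, map_one]
    calc f k⁻¹ = star (f k) * f k * f k⁻¹ := by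
          rw [Matrix.mem_unitaryGroup_iff'.1 (hf k), one_mul]
      _ = star (f k) := by rw [mul_assoc, h₁, mul_one]
  have hstar : star (monomialHom f p) = monomialHom f p⁻¹ := by
    ext ⟨i, x⟩ ⟨j, y⟩
    rw [Matrix.star_apply, monomialHom_apply, monomialHom_apply, PermWreath.inv_left_apply, hinv,
      SemidirectProduct.inv_right, inv_inv]
    by_cases h : p.right x = y
    · rw [if_pos (by rw [← h]; simp), if_pos h, Matrix.star_apply, h]
    · rw [if_neg (fun h' => h (by rw [← h']; simp)), if_neg h, star_zero]
  rw [Matrix.mem_unitaryGroup_iff', hstar, ← map_mul, inv_mul_cancel, map_one]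

/-- Over a moved point the unitary block and the identity block lie in different columns, so their
squared norms, each equal to the size of the block, add up. -/
theorem sumNormSq_monomialHom_sub_one {f : K →* Matrix m m ℂ}
    (hf : ∀ k, f k ∈ Matrix.unitaryGroup m ℂ) (p : PermWreath K X) :
    sumNormSq (monomialHom f p - 1) = ∑ x, if p.right⁻¹ x = x then sumNormSq (f (p.left x) - 1)
      else 2 * (Fintype.card m : ℝ) := by
  rw [sumNormSq, Fintype.sum_prod_type_right]
  refine Finset.sum_congr rfl fun x _ => ?_
  simp only [Fintype.sum_prod_type]
  by_cases hx : p.right⁻¹ x = x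
  · rw [if_pos hx, sumNormSq]
    refine Finset.sum_congr rfl fun i _ => Finset.sum_congr rfl fun j _ => ?_
    rw [Finset.sum_eq_single x]
    · rw [monomialHom_sub_one_apply_of_fixed f hx, if_pos rfl]
    · intro y _ hy
      rw [monomialHom_sub_one_apply_of_fixed f hx, if_neg hy.symm]
      simp
    · simp
  · have h : ∀ i j y, ‖(monomialHom f p - 1) (i, x) (j, y)‖ ^ 2 =
        (if p.right⁻¹ x = y then ‖f (p.left x) i j‖ ^ 2 else 0) +
          (if x = y then ‖(1 : Matrix m m ℂ) i j‖ ^ 2 else 0) := by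
      intro i j y
      rw [Matrix.sub_apply, monomialHom_apply]
      by_cases hy : p.right⁻¹ x = y
      · have hxy : x ≠ y := fun h => hx (hy.trans h.symm)
        rw [if_pos hy, if_pos hy, if_neg hxy, Matrix.one_apply_ne (by simp [hxy]), sub_zero,
          add_zero]
      · rw [if_neg hy, if_neg hy, zero_sub, norm_neg, zero_add]
        by_cases hxy : x = y
        · subst hxy
          simp [Matrix.one_apply]
        · rw [if_neg hxy, Matrix.one_apply_ne (by simp [hxy]), norm_zero, sq, zero_mul]
    simp only [h, Finset.sum_add_distrib, Finset.sum_ite_eq, Finset.mem_univ, if_true]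
    have h₁ := sumNormSq_of_mem_unitary (hf (p.left x))
    have h₂ := sumNormSq_one (ι := m)
    rw [sumNormSq] at h₁ h₂
    rw [h₁, h₂, if_neg hx]
    ring

end

theorem isPermWreathClosed_unitary :
    IsPermWreathClosed {K | ∃ (n : ℕ) (hn : 0 < n), K = unitaryMetricGroup n hn} := by
  classical
  rintro _ ⟨n, hn, rfl⟩ X _ _
  have := Fin.pos_iff_nonempty.1 hn
  have hn' : (0 : ℝ) < n := by positivity
  have hX : (0 : ℝ) < Fintype.card X := by exact_mod_cast Fintype.card_pos
  have hd := isBiInvariantMetric_hilbertSchmidtDist hn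
  let U := Matrix.unitaryGroup (Fin n) ℂ
  let f : U →* Matrix (Fin n) (Fin n) ℂ := U.subtype
  have hf : ∀ k, f k ∈ Matrix.unitaryGroup (Fin n) ℂ := fun k => k.2
  obtain ⟨M, hM, ω, hω⟩ := exists_unitary_hom (monomialHom (X := X) f)
    (monomialHom_mem_unitaryGroup hf)
  suffices key : ∀ p : PermWreath U X,
      M.dist (ω p) 1 ≤ 2 * √(PermWreath.wreathDist hilbertSchmidtDist p 1) ∧
      (p.right = 1 → PermWreath.wreathDist hilbertSchmidtDist p 1 ≤ M.dist (ω p) 1) ∧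
      ((PermWreath.moved p).card : ℝ) ≤ 3 * Fintype.card X * M.dist (ω p) 1 from
    ⟨M, hM, ω, key⟩
  intro p
  set s : X → ℝ := fun x => if p.right⁻¹ x = x then sumNormSq (f (p.left x) - 1) / n else 2
    with hs
  have hdist : M.dist (ω p) 1 = √((∑ x, s x) / Fintype.card X) := by
    have h : ∑ x, s x = sumNormSq (monomialHom f p - 1) / n := by
      rw [sumNormSq_monomialHom_sub_one hf, Finset.sum_div]
      refine Finset.sum_congr rfl fun x _ => ?_
      simp only [hs]
      split_ifs
      · rfl
      · rw [Fintype.card_fin]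
        field_simp
    rw [hω, h, Fintype.card_prod, Fintype.card_fin, Nat.cast_mul, div_div]
  have hs₀ : ∀ x, 0 ≤ s x := fun x => by
    simp only [hs]
    split_ifs
    · exact div_nonneg (sumNormSq_nonneg _) hn'.le
    · norm_num
  have hsq : ∀ k : U, hilbertSchmidtDist k 1 ^ 2 = sumNormSq (f k - 1) / n := fun k => by
    have h : hilbertSchmidtDist k 1 = hilbertSchmidtNorm (f k - 1) := rfl
    rw [h, hilbertSchmidtNorm_eq_sqrt, Real.sq_sqrt (div_nonneg (sumNormSq_nonneg _) hn'.le)]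
  have htwo : ∀ k : U, hilbertSchmidtDist k 1 ^ 2 ≤ 4 := fun k => by
    rw [hsq, div_le_iff₀ hn']
    simpa using sumNormSq_sub_one_le (hf k)
  set c : X → ℝ := PermWreath.coordDist hilbertSchmidtDist p 1 with hc
  have hc₀ : ∀ x, 0 ≤ c x := PermWreath.coordDist_nonneg hd p 1
  -- The first bound holds because squared distances of unitaries from `1` are at most `4`; it gives
  -- the upper estimate `2 * √`. The second gives the lower estimate through the Cauchy-Schwarz
  -- inequality.
  have hcs : ∀ x, s x ≤ 4 * c x ∧ c x ^ 2 ≤ s x := by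
    intro x
    by_cases hx : p.right⁻¹ x = x
    · have hsx : s x = hilbertSchmidtDist (p.left x) 1 ^ 2 := by
        rw [hsq]
        exact if_pos hx
      have hcx : c x = min (hilbertSchmidtDist (p.left x) 1) 1 :=
        PermWreath.coordDist_of_eq (by simpa using hx)
      rw [hsx, hcx]
      have h₁ := htwo (p.left x)
      have h₀ := hd.nonneg (p.left x) 1
      rcases min_cases (hilbertSchmidtDist (p.left x) 1) 1 with h | h <;> rw [h.1]
      · exact ⟨by nlinarith, le_rfl⟩
      · exact ⟨by linarith, by nlinarith⟩
    · have hsx : s x = 2 := if_neg hx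
      have hcx : c x = 1 := PermWreath.coordDist_of_ne (by simpa using hx)
      rw [hsx, hcx]
      norm_num
  have hA : PermWreath.wreathDist hilbertSchmidtDist p 1 = (∑ x, c x) / Fintype.card X := rfl
  have hlower : PermWreath.wreathDist hilbertSchmidtDist p 1 ≤ M.dist (ω p) 1 := by
    rw [hdist, hA]
    refine Real.le_sqrt_of_sq_le ?_
    have h₁ : (∑ x, c x) ^ 2 ≤ Fintype.card X * ∑ x, c x ^ 2 :=
      sq_sum_le_card_mul_sum_sq
    have h₂ : ∑ x, c x ^ 2 ≤ ∑ x, s x := Finset.sum_le_sum fun x _ => (hcs x).2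
    rw [div_pow, div_le_div_iff₀ (by positivity) hX, sq (Fintype.card X : ℝ), ← mul_assoc]
    refine mul_le_mul_of_nonneg_right (h₁.trans ?_) hX.le
    rw [mul_comm]
    exact mul_le_mul_of_nonneg_right h₂ hX.le
  refine ⟨?_, fun _ => hlower, ?_⟩
  · rw [hdist, hA]
    have h : (2 : ℝ) = √4 := by
      rw [show (4 : ℝ) = 2 ^ 2 by norm_num, Real.sqrt_sq (by norm_num)]
    rw [h, ← Real.sqrt_mul (by norm_num), mul_div_assoc', Finset.mul_sum]
    gcongr with x
    exact (hcs x).1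
  · have h₁ : ((PermWreath.moved p).card : ℝ) ≤ ∑ x, c x := PermWreath.card_moved_le hd p
    rw [hA, div_le_iff₀ hX] at hlower
    nlinarith [Finset.sum_nonneg fun x (_ : x ∈ Finset.univ) => hc₀ x]

theorem IsHyperlinear.restrictedWreathProduct {G : Type u} {H : Type v} [Group G] [Group H]
    (hH : IsSofic H) (hG : IsHyperlinear G) : IsHyperlinear (restrictedWreathProduct G H) :=
  IsApproximable.restrictedWreathProduct isTensorClosed_unitary isPermWreathClosed_unitary hH hG

end Hyperlinear

end WreathApprox

theorem theoremB (G : Type*) (H : Type*) [Group G] [Group H]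
    [Countable G] [Countable H] (hH : WreathApprox.IsSofic H) :
    (WreathApprox.IsSofic G →
      WreathApprox.IsSofic (WreathApprox.restrictedWreathProduct G H)) ∧
    (WreathApprox.IsHyperlinear G →
      WreathApprox.IsHyperlinear (WreathApprox.restrictedWreathProduct G H)) ∧
    (∀ (𝔽 : Type*) [Field 𝔽], WreathApprox.IsLinearSofic 𝔽 G →
      WreathApprox.IsLinearSofic 𝔽 (WreathApprox.restrictedWreathProduct G H)) ∧
    (WreathApprox.IsWeaklySofic G →
      WreathApprox.IsWeaklySofic (WreathApprox.restrictedWreathProduct G H)) := by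
  exact ⟨WreathApprox.IsSofic.restrictedWreathProduct hH,
    WreathApprox.IsHyperlinear.restrictedWreathProduct hH,
    fun _ _ => WreathApprox.IsLinearSofic.restrictedWreathProduct hH,
    WreathApprox.IsWeaklySofic.restrictedWreathProduct hH⟩
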